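/- A DG algebra is a $\mathbb Z$-graded associative unital ring $B=\bigoplus_i B_i$ with a differential $\partial$ of degree $-1$, $\partial^2=0$, satisfying the Leibniz rule $\partial(ab)=\partial(a)b+(-1)^{|a|}a\,\partial(b)$; it is assumed graded-commutative: $ab=(-1)^{|a||b|}ba$ for homogeneous $a,b$, and $a^2=0$ when $|a|$ is odd. Left DG $B$-modules are defined similarly (differential of degree $-1$). A left DG module over such a $B$ is also a right one via $mb=(-1)^{|b||m|}bm$. $(B,\mathfrak n,k)$ is a local DG algebra if $B_i=0$ for $i<0$, $B_0$ is a noetherian local ring with maximal ideal $\mathfrak n_0$ and residue field $k=B_0/\mathfrak n_0$, $\mathfrak n_i=B_i$ for $i\neq 0$, every $H_i(B)$ is a finitely generated $H_0(B)$-module, and $H_0(B)\ne 0$. Then $k=B/\mathfrak n$ is a DG $B$-module concentrated in degree $0$. A semibasis of a DG $B$-module $F$ is a well-ordered set $S$ of homogeneous elements of $F$ that is a basis of the graded module underlying $F$ over the graded ring underlying $B$ and satisfies $\partial(f)\in\sum_{e\in S,\,e<f}Be$ for every $f\in S$. A DG module is (finite) semifree if it has a (finite) semibasis. Two DG modules are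 quasi-isomorphic if they are linked by a finite chain of quasi-isomorphisms of DG modules, in either direction. A DG module is perfect if it is quasi-isomorphic to a direct summand of a finite semifree DG module. For DG modules $L,N$, $\operatorname{Tor}^B_i(L,N)=H_i(L\otimes_B G)$, where $G\to N$ is a quasi-isomorphism with $G$ semifree. A graded module $H$ is bounded below if $H_i=0$ for $i\ll0$, and bounded if $H_i=0$ for $|i|\gg0$; $H(M)$ is degreewise finite if each $H_i(M)$ is a finitely generated $H_0(B)$-module. **Proposition.** Let $(B,\mathfrak n,k)$ be a local DG algebra and $M$ a left DG $B$-module. The following conditions are equivalent: (i) $M$ is perfect. (ii) $M$ is quasi-isomorphic to a finite semifree DG $B$-module. (iii) $H(M)$ is bounded below and degreewise finite, and $\operatorname{Tor}^B(M,k)$ is bounded. -/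

import Mathlib

universe u v w

/-- A graded-commutative differential graded algebra (over `ℤ`): a `ℤ`-graded ring with a
differential of degree `-1` that satisfies the Leibniz rule. The ring `carrier` is the direct sum of
its homogeneous components `gr i`. -/
structure DGAlgebra : Type (u + 1) where
  carrier : Type u
  [ring : Ring carrier]
  gr : ℤ → AddSubgroup carrier
  [gradedRing : GradedRing gr]
  d : carrier →+ carrier
  d_mem : ∀ {i : ℤ} {b : carrier}, b ∈ gr i → d b ∈ gr (i - 1)
  d_d : ∀ b : carrier, d (d b) = 0
  d_mul : ∀ {i : ℤ} {a : carrier}, a ∈ gr i → ∀ b : carrier,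
    d (a * b) = d a * b + i.negOnePow • (a * d b)
  graded_comm : ∀ {i j : ℤ} {a b : carrier}, a ∈ gr i → b ∈ gr j →
    a * b = (i * j).negOnePow • (b * a)
  odd_sq : ∀ {i : ℤ} {a : carrier}, Odd i → a ∈ gr i → a * a = 0

namespace DGAlgebra

instance : CoeSort DGAlgebra.{u} (Type u) := ⟨DGAlgebra.carrier⟩

attribute [instance] DGAlgebra.ring DGAlgebra.gradedRing

variable (B : DGAlgebra.{u})

theorem one_mem_gr : (1 : B) ∈ B.gr 0 := SetLike.GradedOne.one_mem

theorem mul_mem_gr {i j : ℤ} {a b : B} (ha : a ∈ B.gr i) (hb : b ∈ B.gr j) :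
    a * b ∈ B.gr (i + j) := SetLike.GradedMul.mul_mem ha hb

theorem d_one : B.d 1 = 0 := by
  have h := B.d_mul B.one_mem_gr 1
  simpa using h

/-- The degree zero component of a graded-commutative DG algebra is a commutative ring. -/
instance commRingGrZero : CommRing (B.gr 0) :=
  { (inferInstance : Ring (B.gr 0)) with
    mul_comm := fun a b => Subtype.ext (by
      have h := B.graded_comm a.2 b.2
      simpa using h) }

/-- The subring of cycles of degree zero. -/
def cyclesZero : Subring B where
  carrier := {b | b ∈ B.gr 0 ∧ B.d b = 0}
  zero_mem' := ⟨zero_mem _, map_zero _⟩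
  one_mem' := ⟨B.one_mem_gr, B.d_one⟩
  add_mem' := fun {a b} ha hb => ⟨add_mem ha.1 hb.1, by rw [map_add, ha.2, hb.2, add_zero]⟩
  neg_mem' := fun {a} ha => ⟨neg_mem ha.1, by rw [map_neg, ha.2, neg_zero]⟩
  mul_mem' := fun {a b} ha hb =>
    ⟨by simpa using B.mul_mem_gr ha.1 hb.1, by rw [B.d_mul ha.1, ha.2, hb.2]; simp⟩

instance : CommRing B.cyclesZero :=
  { (inferInstance : Ring B.cyclesZero) with
    mul_comm := fun a b => Subtype.ext (by
      have h := B.graded_comm a.2.1 b.2.1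
      simpa using h) }

/-- The ideal of boundaries in the ring of cycles of degree zero. -/
def boundariesZero : Ideal B.cyclesZero where
  carrier := {z | ∃ b ∈ B.gr 1, B.d b = z}
  zero_mem' := ⟨0, zero_mem _, by simp⟩
  add_mem' := by
    rintro _ _ ⟨a, ha, ha'⟩ ⟨b, hb, hb'⟩
    exact ⟨a + b, add_mem ha hb, by simp [ha', hb']⟩
  smul_mem' := by
    rintro c _ ⟨b, hb, hb'⟩
    refine ⟨c * b, by simpa using B.mul_mem_gr c.2.1 hb, ?_⟩
    rw [B.d_mul c.2.1, c.2.2, hb']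
    simp

/-- The ring `H₀(B)`. -/
abbrev HZero : Type u := B.cyclesZero ⧸ B.boundariesZero

end DGAlgebra

/-- The grading of an abelian group that is concentrated in degree zero. -/
def grConcentrated (X : Type u) [AddCommGroup X] (i : ℤ) : AddSubgroup X :=
  if i = 0 then ⊤ else ⊥

theorem mem_grConcentrated_zero {X : Type u} [AddCommGroup X] (x : X) :
    x ∈ grConcentrated X 0 := by
  simp [grConcentrated]

theorem eq_zero_of_mem_grConcentrated {X : Type u} [AddCommGroup X] {i : ℤ} (hi : i ≠ 0) {x : X}
    (hx : x ∈ grConcentrated X i) : x = 0 := by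
  simpa [grConcentrated, hi] using hx

instance (X : Type u) [AddCommGroup X] : DirectSum.Decomposition (grConcentrated X) :=
  DirectSum.Decomposition.ofAddHom (grConcentrated X)
    ((DirectSum.of (fun i => grConcentrated X i) 0).comp
      ((AddMonoidHom.id X).codRestrict (grConcentrated X 0) mem_grConcentrated_zero))
    (by ext x; simp)
    (by
      ext i x : 2
      by_cases hi : i = 0
      · subst hi
        simp
      · have hx : x = 0 := Subtype.ext (eq_zero_of_mem_grConcentrated hi x.2)
        subst hx
        simp only [map_zero])

/-- A left DG module over the DG algebra `B`. -/
structure DGModule (B : DGAlgebra.{u}) : Type (max u (v + 1)) where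
  carrier : Type v
  [addCommGroup : AddCommGroup carrier]
  [module : Module B carrier]
  gr : ℤ → AddSubgroup carrier
  [decomposition : DirectSum.Decomposition gr]
  smul_mem : ∀ {i j : ℤ} {b : B} {m : carrier}, b ∈ B.gr i → m ∈ gr j → b • m ∈ gr (i + j)
  d : carrier →+ carrier
  d_mem : ∀ {i : ℤ} {m : carrier}, m ∈ gr i → d m ∈ gr (i - 1)
  d_d : ∀ m : carrier, d (d m) = 0
  d_smul : ∀ {i : ℤ} {b : B}, b ∈ B.gr i → ∀ m : carrier,
    d (b • m) = B.d b • m + i.negOnePow • (b • d m)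

namespace DGModule

variable {B : DGAlgebra.{u}}

instance : CoeSort (DGModule.{u, v} B) (Type v) := ⟨DGModule.carrier⟩

attribute [instance] DGModule.addCommGroup DGModule.module DGModule.decomposition

section Homology

variable (M : DGModule.{u, v} B)

/-- The cycles of degree `i`, a module over the ring of cycles of degree zero in `B`. -/
def cycles (i : ℤ) : Submodule B.cyclesZero M where
  carrier := {m | m ∈ M.gr i ∧ M.d m = 0}
  zero_mem' := ⟨zero_mem _, map_zero _⟩
  add_mem' := fun {a b} ha hb => ⟨add_mem ha.1 hb.1, by rw [map_add, ha.2, hb.2, add_zero]⟩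
  smul_mem' := fun c m hm => by
    change (c : B) • m ∈ M.gr i ∧ M.d ((c : B) • m) = 0
    refine ⟨by simpa using M.smul_mem c.2.1 hm.1, ?_⟩
    rw [M.d_smul c.2.1, c.2.2, hm.2]
    simp

/-- The boundaries of degree `i`, as a submodule of the cycles. -/
def boundaries (i : ℤ) : Submodule B.cyclesZero (M.cycles i) where
  carrier := {z | ∃ m ∈ M.gr (i + 1), M.d m = z}
  zero_mem' := ⟨0, zero_mem _, by simp⟩
  add_mem' := by
    rintro _ _ ⟨a, ha, ha'⟩ ⟨b, hb, hb'⟩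
    exact ⟨a + b, add_mem ha hb, by simp [ha', hb']⟩
  smul_mem' := by
    rintro c _ ⟨m, hm, hm'⟩
    refine ⟨(c : B) • m, by simpa using M.smul_mem c.2.1 hm, ?_⟩
    rw [M.d_smul c.2.1, c.2.2, hm']
    simp [Subring.smul_def]

/-- The homology `Hᵢ(M)`. -/
abbrev homology (i : ℤ) : Type v := M.cycles i ⧸ M.boundaries i

theorem isTorsionBySet_homology (i : ℤ) :
    Module.IsTorsionBySet B.cyclesZero (M.homology i) B.boundariesZero := by
  intro x a
  obtain ⟨x, rfl⟩ := Submodule.Quotient.mk_surjective _ x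
  obtain ⟨b, hb, hba⟩ := a.2
  rw [← Submodule.Quotient.mk_smul, Submodule.Quotient.mk_eq_zero]
  refine ⟨b • (x : M), by simpa [add_comm] using M.smul_mem hb x.2.1, ?_⟩
  rw [M.d_smul hb, x.2.2, hba, smul_zero, smul_zero, add_zero]
  rfl

/-- `Hᵢ(M)` is a module over the ring `H₀(B)`. -/
instance (i : ℤ) : Module B.HZero (M.homology i) :=
  (M.isTorsionBySet_homology i).module

/-- `H(M)` is bounded below. -/
def HomologyBoundedBelow : Prop := ∃ n : ℤ, ∀ i < n, Subsingleton (M.homology i)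

/-- `H(M)` is degreewise finite: every `Hᵢ(M)` is a finitely generated `H₀(B)`-module. -/
def HomologyDegreewiseFinite : Prop := ∀ i : ℤ, Module.Finite B.HZero (M.homology i)

end Homology

/-- A morphism of DG modules: a linear map of degree zero that commutes with the differentials. -/
structure Hom (M : DGModule.{u, v} B) (N : DGModule.{u, w} B) where
  toLinearMap : M →ₗ[B] N
  map_gr : ∀ {i : ℤ} {m : M}, m ∈ M.gr i → toLinearMap m ∈ N.gr i
  map_d : ∀ m : M, toLinearMap (M.d m) = N.d (toLinearMap m)

namespace Hom

variable {M : DGModule.{u, v} B} {N : DGModule.{u, w} B} (f : Hom M N)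

/-- The map induced on cycles of degree `i`. -/
def cyclesMap (i : ℤ) : M.cycles i →ₗ[B.cyclesZero] N.cycles i where
  toFun z := ⟨f.toLinearMap z, f.map_gr z.2.1, by rw [← f.map_d, z.2.2, map_zero]⟩
  map_add' _ _ := Subtype.ext (map_add _ _ _)
  map_smul' c z := Subtype.ext (f.toLinearMap.map_smul (c : B) (z : M))

/-- The map `Hᵢ(f)`. -/
def homologyMap (i : ℤ) : M.homology i →ₗ[B.cyclesZero] N.homology i :=
  Submodule.mapQ _ _ (f.cyclesMap i) (by
    rintro z ⟨m, hm, hmz⟩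
    exact ⟨f.toLinearMap m, f.map_gr hm, by rw [← f.map_d, hmz]; rfl⟩)

/-- A quasi-isomorphism: a morphism that is bijective in homology. -/
def IsQuasiIso : Prop := ∀ i : ℤ, Function.Bijective (f.homologyMap i)

end Hom

/-- Two DG modules are quasi-isomorphic if a finite chain of quasi-isomorphisms, pointing in either
direction, links them. -/
def QuasiIsomorphic (M N : DGModule.{u, v} B) : Prop :=
  Relation.EqvGen (fun P Q : DGModule.{u, v} B => ∃ f : Hom P Q, f.IsQuasiIso) M N

/-- The set `S`, well-ordered by `r`, is a semibasis of `F`: its elements are homogeneous, it is a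
basis of the underlying graded module, and `d f` lies in the span of the elements that precede `f`,
for every `f` in `S`. -/
structure IsSemibasis (F : DGModule.{u, v} B) (S : Set F) (r : S → S → Prop) : Prop where
  isWellOrder : IsWellOrder S r
  homogeneous : ∀ f ∈ S, ∃ i : ℤ, f ∈ F.gr i
  linearIndependent : LinearIndependent B (Subtype.val : S → F)
  span_eq_top : Submodule.span B S = ⊤
  d_mem_span : ∀ f : S, F.d f ∈ Submodule.span B {x : F | ∃ e : S, r e f ∧ (e : F) = x}

/-- A DG module that has a semibasis. -/
def IsSemifree (F : DGModule.{u, v} B) : Prop :=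
  ∃ (S : Set F) (r : S → S → Prop), F.IsSemibasis S r

/-- A DG module that has a finite semibasis. -/
def IsFiniteSemifree (F : DGModule.{u, v} B) : Prop :=
  ∃ (S : Set F) (r : S → S → Prop), S.Finite ∧ F.IsSemibasis S r

/-- `P` is (isomorphic to) a direct summand of `F`, in the category of DG modules. -/
def IsDirectSummand (P F : DGModule.{u, v} B) : Prop :=
  ∃ (s : Hom P F) (p : Hom F P), ∀ x : P, p.toLinearMap (s.toLinearMap x) = x

/-- A DG module that is quasi-isomorphic to a direct summand of some finite semifree DG module. -/
def IsPerfect (M : DGModule.{u, v} B) : Prop :=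
  ∃ F P : DGModule.{u, v} B, F.IsFiniteSemifree ∧ P.IsDirectSummand F ∧ M.QuasiIsomorphic P

/-- The zero DG module. -/
def zero (B : DGAlgebra.{u}) : DGModule.{u, v} B where
  carrier := PUnit.{v + 1}
  gr := grConcentrated PUnit.{v + 1}
  smul_mem _ _ := by
    rw [Subsingleton.elim (_ • _) (0 : PUnit.{v + 1})]
    exact zero_mem _
  d := (0 : PUnit.{v + 1} →+ PUnit.{v + 1})
  d_mem _ := zero_mem _
  d_d _ := rfl
  d_smul _ _ := rfl

instance : Nonempty (DGModule.{u, v} B) := ⟨zero B⟩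

section Tensor

open scoped TensorProduct

variable (L : DGModule.{u, v} B) (N : DGModule.{u, w} B)

/-- The additive map that multiplies each homogeneous element `x` of degree `i` by `(-1) ^ i`. -/
noncomputable def signMap : L →+ L :=
  (DirectSum.toAddMonoid (fun i : ℤ => i.negOnePow • (L.gr i).subtype)).comp
    (DirectSum.decomposeAddEquiv L.gr).toAddMonoidHom

theorem signMap_of_mem {i : ℤ} {x : L} (hx : x ∈ L.gr i) :
    L.signMap x = i.negOnePow • x := by
  lift x to L.gr i using hx
  simp [signMap, DirectSum.decompose_coe]

/-- The relations `l · b ⊗ n = l ⊗ b • n` that define `L ⊗[B] N` as a quotient of `L ⊗[ℤ] N`, where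
the right action of `B` on `L` is `l · b = (-1) ^ (|b| * |l|) • b • l`. -/
def tensorRelations : AddSubgroup (L ⊗[ℤ] N) :=
  AddSubgroup.closure {t | ∃ (i j : ℤ) (b : B) (l : L) (n : N), b ∈ B.gr i ∧ l ∈ L.gr j ∧
    t = ((i * j).negOnePow • (b • l)) ⊗ₜ[ℤ] n - l ⊗ₜ[ℤ] (b • n)}

/-- The underlying abelian group of the tensor product `L ⊗[B] N` of DG modules over a
graded-commutative DG algebra. -/
abbrev Tensor : Type (max v w) := (L ⊗[ℤ] N) ⧸ tensorRelations L N

/-- The component of degree `n` of `L ⊗[B] N`. -/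
def tensorGr (n : ℤ) : AddSubgroup (Tensor L N) :=
  AddSubgroup.closure {t | ∃ (i j : ℤ) (x : L) (y : N), i + j = n ∧ x ∈ L.gr i ∧ y ∈ N.gr j ∧
    t = QuotientAddGroup.mk (x ⊗ₜ[ℤ] y)}

/-- The map `x ⊗ y ↦ d x ⊗ y + (-1) ^ |x| • x ⊗ d y` on `L ⊗[ℤ] N`. -/
noncomputable def tensorDInt : L ⊗[ℤ] N →+ L ⊗[ℤ] N :=
  (TensorProduct.map L.d.toIntLinearMap LinearMap.id +
    TensorProduct.map L.signMap.toIntLinearMap N.d.toIntLinearMap).toAddMonoidHom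

theorem tensorDInt_tmul {i : ℤ} {x : L} (hx : x ∈ L.gr i) (y : N) :
    tensorDInt L N (x ⊗ₜ[ℤ] y) = L.d x ⊗ₜ[ℤ] y + i.negOnePow • (x ⊗ₜ[ℤ] N.d y) := by
  simp [tensorDInt, signMap_of_mem L hx, Units.smul_def, TensorProduct.smul_tmul']

theorem tensorDInt_mem : tensorRelations L N ≤ (tensorRelations L N).comap (tensorDInt L N) := by
  rw [tensorRelations, AddSubgroup.closure_le]
  rintro _ ⟨i, j, b, l, n, hb, hl, rfl⟩
  have key : ∀ {i j : ℤ} {b : B} {l : L} (n : N), b ∈ B.gr i → l ∈ L.gr j →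
      ((i * j).negOnePow • (b • l)) ⊗ₜ[ℤ] n - l ⊗ₜ[ℤ] (b • n) ∈ tensorRelations L N :=
    fun {i j b l} n hb hl => AddSubgroup.subset_closure ⟨i, j, b, l, n, hb, hl, rfl⟩
  have h1 := key n (B.d_mem hb) hl
  have h2 := key n hb (L.d_mem hl)
  have h3 := key (N.d n) hb hl
  have e1 : ((i - 1) * j).negOnePow = (i * j).negOnePow * j.negOnePow := by
    rw [← Int.negOnePow_add, Int.negOnePow_eq_iff]
    exact ⟨-j, by ring⟩
  have e2 : (i * (j - 1)).negOnePow = (i * j).negOnePow * i.negOnePow := by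
    rw [← Int.negOnePow_add, Int.negOnePow_eq_iff]
    exact ⟨-i, by ring⟩
  rw [e1] at h1
  rw [e2] at h2
  have hbl : (i * j).negOnePow • (b • l) ∈ L.gr (i + j) := by
    rcases Int.units_eq_one_or (i * j).negOnePow with h | h <;> rw [h] <;>
      simpa using L.smul_mem hb hl
  change tensorDInt L N _ ∈ tensorRelations L N
  rw [map_sub, tensorDInt_tmul L N hbl, tensorDInt_tmul L N hl, N.d_smul hb, Int.negOnePow_add]
  have hd : L.d ((i * j).negOnePow • (b • l)) =
      (i * j).negOnePow • (B.d b • l + i.negOnePow • (b • L.d l)) := by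
    rw [← L.d_smul hb, Units.smul_def, Units.smul_def, map_zsmul]
  rw [hd]
  rcases Int.units_eq_one_or (i * j).negOnePow with hij | hij <;>
  rcases Int.units_eq_one_or i.negOnePow with hi | hi <;>
  rcases Int.units_eq_one_or j.negOnePow with hj | hj <;>
  simp only [hij, hi, hj, one_smul, mul_one, Units.neg_smul, TensorProduct.add_tmul,
    TensorProduct.tmul_add, TensorProduct.neg_tmul, TensorProduct.tmul_neg, smul_neg, neg_neg,
    mul_neg] at h1 h2 h3 ⊢
  all_goals first
    | (convert add_mem (add_mem h1 h2) h3 using 1; abel1)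
    | (convert sub_mem (add_mem h1 h2) h3 using 1; abel1)
    | (convert add_mem (sub_mem h2 h1) h3 using 1; abel1)
    | (convert sub_mem (sub_mem h2 h1) h3 using 1; abel1)

/-- The differential of `L ⊗[B] N`. -/
noncomputable def tensorD : Tensor L N →+ Tensor L N :=
  QuotientAddGroup.map _ _ (tensorDInt L N) (tensorDInt_mem L N)

/-- The cycles of degree `n` in `L ⊗[B] N`. -/
noncomputable def tensorCycles (n : ℤ) : AddSubgroup (Tensor L N) :=
  tensorGr L N n ⊓ (tensorD L N).ker

/-- The boundaries of degree `n` in `L ⊗[B] N`. -/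
noncomputable def tensorBoundaries (n : ℤ) : AddSubgroup (Tensor L N) :=
  (tensorGr L N (n + 1)).map (tensorD L N)

/-- The homology `Hₙ(L ⊗[B] N)`. -/
abbrev tensorHomology (n : ℤ) : Type (max v w) :=
  tensorCycles L N n ⧸ (tensorBoundaries L N n).addSubgroupOf (tensorCycles L N n)

/-- `G` is the source of a semifree resolution `G → N`. -/
def IsSemifreeResolutionOf (G : DGModule.{u, max u w} B) (N : DGModule.{u, w} B) : Prop :=
  G.IsSemifree ∧ ∃ f : Hom G N, f.IsQuasiIso

/-- A chosen semifree resolution of `N`. (Every DG module has semifree resolutions.) -/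
noncomputable def semifreeResolution : DGModule.{u, max u w} B :=
  Classical.epsilon (fun G => IsSemifreeResolutionOf G N)

/-- `Tor^B_n(L, N) = Hₙ(L ⊗[B] G)`, where `G → N` is the chosen semifree resolution. -/
noncomputable abbrev Tor (n : ℤ) : Type (max u v w) := tensorHomology L (semifreeResolution N) n

/-- `Tor^B(L, N)` is bounded. -/
def TorBounded : Prop := ∃ n : ℤ, ∀ i : ℤ, n < |i| → Subsingleton (Tor L N i)

end Tensor

end DGModule

namespace DGAlgebra

variable (B : DGAlgebra.{u})

/-- `B` as a DG module over itself. -/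
def self : DGModule.{u, u} B where
  carrier := B
  gr := B.gr
  smul_mem := B.mul_mem_gr
  d := B.d
  d_mem := B.d_mem
  d_d := B.d_d
  d_smul := B.d_mul

/-- `B` is a local DG algebra; its maximal ideal is the maximal ideal of `B₀` in degree `0` and
`Bᵢ` in degree `i ≠ 0`. -/
structure IsLocal : Prop where
  gr_neg : ∀ i < 0, B.gr i = ⊥
  isNoetherianRing : IsNoetherianRing (B.gr 0)
  isLocalRing : IsLocalRing (B.gr 0)
  degreewiseFinite : B.self.HomologyDegreewiseFinite
  nontrivial_HZero : Nontrivial B.HZero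

variable {B}

/-- The projection of a non-negatively graded DG algebra onto its component of degree zero. -/
noncomputable def projZero (h : ∀ i < 0, B.gr i = ⊥) : B →+* B.gr 0 where
  toFun b := DirectSum.decompose B.gr b 0
  map_zero' := by simp
  map_add' a b := by simp
  map_one' := by
    apply Subtype.ext
    exact DirectSum.decompose_of_mem_same B.gr B.one_mem_gr
  map_mul' a b := by
    have hneg : ∀ {i : ℤ} {c : B}, c ∈ B.gr i → i < 0 → c = 0 := fun {i c} hc hi => by
      rw [h i hi] at hc
      exact hc
    have hom : ∀ {i j : ℤ} {x y : B}, x ∈ B.gr i → y ∈ B.gr j →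
        DirectSum.decompose B.gr (x * y) 0 =
          DirectSum.decompose B.gr x 0 * DirectSum.decompose B.gr y 0 := by
      intro i j x y hx hy
      apply Subtype.ext
      rcases lt_or_ge i 0 with hi | hi
      · rw [hneg hx hi]
        simp
      rcases lt_or_ge j 0 with hj | hj
      · rw [hneg hy hj]
        simp
      rw [SetLike.GradeZero.coe_mul]
      by_cases hi' : i = 0
      · subst hi'
        by_cases hj' : j = 0
        · subst hj'
          have hxy : x * y ∈ B.gr 0 := by simpa using B.mul_mem_gr hx hy
          rw [DirectSum.decompose_of_mem_same B.gr hxy, DirectSum.decompose_of_mem_same B.gr hx,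
            DirectSum.decompose_of_mem_same B.gr hy]
        · rw [DirectSum.decompose_of_mem_ne B.gr (B.mul_mem_gr hx hy) (by lia),
            DirectSum.decompose_of_mem_ne B.gr hy hj', mul_zero]
      · rw [DirectSum.decompose_of_mem_ne B.gr (B.mul_mem_gr hx hy) (by lia),
          DirectSum.decompose_of_mem_ne B.gr hx hi', zero_mul]
    induction a using DirectSum.Decomposition.inductionOn B.gr with
    | zero => simp
    | add a a' ha ha' =>
      simp only [add_mul, DirectSum.decompose_add, DirectSum.add_apply, ha, ha']
    | @homogeneous i a =>
      induction b using DirectSum.Decomposition.inductionOn B.gr with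
      | zero => simp
      | add b b' hb hb' =>
        simp only [mul_add, DirectSum.decompose_add, DirectSum.add_apply, hb, hb']
      | @homogeneous j b => exact hom a.2 b.2

theorem projZero_of_mem (h : ∀ i < 0, B.gr i = ⊥) {b : B} (hb : b ∈ B.gr 0) :
    projZero h b = ⟨b, hb⟩ :=
  Subtype.ext (DirectSum.decompose_of_mem_same B.gr hb)

theorem projZero_of_ne (h : ∀ i < 0, B.gr i = ⊥) {i : ℤ} (hi : i ≠ 0) {b : B}
    (hb : b ∈ B.gr i) : projZero h b = 0 :=
  Subtype.ext (DirectSum.decompose_of_mem_ne B.gr hb hi)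

namespace IsLocal

variable (hB : B.IsLocal)

/-- The residue field `k = B₀ / 𝔪₀`. -/
def residueField : Type u :=
  letI := hB.isLocalRing
  IsLocalRing.ResidueField (B.gr 0)

noncomputable instance : Field hB.residueField :=
  letI := hB.isLocalRing
  inferInstanceAs (Field (IsLocalRing.ResidueField (B.gr 0)))

/-- The canonical augmentation `ε : B → k`. -/
noncomputable def augmentation : B →+* hB.residueField :=
  letI := hB.isLocalRing
  (IsLocalRing.residue (B.gr 0)).comp (projZero hB.gr_neg)

theorem augmentation_of_ne {i : ℤ} (hi : i ≠ 0) {b : B} (hb : b ∈ B.gr i) :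
    hB.augmentation b = 0 := by
  let := hB.isLocalRing
  change IsLocalRing.residue (B.gr 0) (projZero hB.gr_neg b) = 0
  rw [projZero_of_ne _ hi hb, map_zero]

theorem augmentation_d_of_mem {i : ℤ} {b : B} (hb : b ∈ B.gr i) : hB.augmentation (B.d b) = 0 := by
  by_cases hi : i = 1
  swap
  · exact hB.augmentation_of_ne (sub_ne_zero.2 hi) (B.d_mem hb)
  subst hi
  let := hB.isLocalRing
  have hd : B.d b ∈ B.gr 0 := by simpa using B.d_mem hb
  change IsLocalRing.residue (B.gr 0) (projZero hB.gr_neg (B.d b)) = 0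
  rw [projZero_of_mem _ hd, IsLocalRing.residue_eq_zero_iff, IsLocalRing.mem_maximalIdeal,
    mem_nonunits_iff]
  intro hu
  obtain ⟨c, hc⟩ := hu.exists_right_inv
  have hcd : B.d b * c = 1 := congrArg Subtype.val hc
  have hc0 : B.d c = 0 := by
    have := B.d_mem c.2
    rw [hB.gr_neg _ (by norm_num)] at this
    exact this
  apply (Ideal.Quotient.nontrivial_iff (I := B.boundariesZero)).1 hB.nontrivial_HZero
  rw [Ideal.eq_top_iff_one]
  refine ⟨b * c, by simpa using B.mul_mem_gr hb c.2, ?_⟩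
  rw [B.d_mul hb, hc0, hcd]
  simp

theorem augmentation_d (b : B) : hB.augmentation (B.d b) = 0 := by
  induction b using DirectSum.Decomposition.inductionOn B.gr with
  | zero => simp
  | add b b' h h' => rw [map_add, map_add, h, h', add_zero]
  | homogeneous b => exact hB.augmentation_d_of_mem b.2

/-- `B` acts on `k` through the canonical augmentation. -/
noncomputable instance : Module B hB.residueField := Module.compHom _ hB.augmentation

theorem smul_residueField_def (b : B) (x : hB.residueField) : b • x = hB.augmentation b * x := rfl

/-- The residue field `k` as a DG `B`-module: it is concentrated in degree zero, has zero
differential, and `B` acts on it through the canonical augmentation. -/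
noncomputable def residueDGModule : DGModule.{u, u} B where
  carrier := hB.residueField
  gr := grConcentrated hB.residueField
  smul_mem {i j b m} hb hm := by
    by_cases hj : j = 0
    · by_cases hi : i = 0
      · subst hi hj
        exact mem_grConcentrated_zero _
      · rw [smul_residueField_def, hB.augmentation_of_ne hi hb, zero_mul]
        exact zero_mem _
    · rw [eq_zero_of_mem_grConcentrated hj hm, smul_zero]
      exact zero_mem _
  d := (0 : hB.residueField →+ hB.residueField)
  d_mem _ := zero_mem _
  d_d _ := rfl
  d_smul {i b} _ m := by
    rw [smul_residueField_def (hB := hB) (B.d b), hB.augmentation_d]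
    simp

end IsLocal

end DGAlgebra

-- (i) ⇒ (iii). The conditions in (iii) are invariant under quasi-isomorphism and pass to direct
-- summands, so only a finite semifree `F` has to be examined. Since `B` is non-negative, `F` is
-- bounded below. Induction on the semibasis, with `H(B)` degreewise finite over the noetherian ring
-- `B₀`, gives degreewise finiteness (`fg_map_cyclesSpan`). For `Tor`, let `G → k` be the semifree
-- resolution: by symmetry of the tensor product the semibasis of `F` can be used, and `H(G) = k`
-- contributes only in the degrees of the generators.
--
-- (iii) ⇒ (ii). This is the construction of a minimal resolution, which stops because `Tor` is
-- bounded. Let `H(M)` vanish below `n`. A cellular resolution allows `M` to be concentrated in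
-- degrees at least `n`. If `H_n(M) ≠ 0`, Nakayama's lemma finds, in any finite generating set, a
-- class `[z]` outside `𝔪 H_n(M)`. It is detected by a `B`-linear map `l : M → k` that kills
-- boundaries and has `l z = 1`. Pairing `l` with `G → k` gives a functional on `M ⊗ G` that kills
-- boundaries, with two consequences. First, `Tor_n(M, k) ≠ 0` (`subsingleton_homology_of_tor`).
-- Second, if `M'` is obtained from `M` by attaching a cell of degree `n + 1` with boundary `z`,
-- then `k → Tor_n(M, k)`, `1 ↦ z ⊗ 1`, is injective, so `Tor_j(M', k) = 0` whenever `Tor_j(M, k) =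
-- 0` (`subsingleton_tor_attach`).
--
-- Meanwhile `H_n(M')` needs one generator fewer. Double induction, on the width of the range of
-- degrees where `Tor` may live and on the number of generators of `H_n`, reaches a module with
-- vanishing `Tor` in degrees at least `n`, which is acyclic by the first consequence. To return
-- from a finite semifree `F → M'` to `M`, take the homotopy fibre of `F → M' → B[n+1]`: it is
-- finite semifree with one more generator and maps quasi-isomorphically to `M`
-- (`isQuasiIso_attachFibreHom`).
--
-- (ii) ⇒ (i) holds because a module is a summand of itself.

universe t

/-! ### Signs acting on abelian groups -/

section UnitsSMul

variable {X Y : Type*} [AddCommGroup X] [AddCommGroup Y]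

theorem AddMonoidHom.map_intUnits_smul (f : X →+ Y) (ε : ℤˣ) (x : X) : f (ε • x) = ε • f x := by
  rcases Int.units_eq_one_or ε with rfl | rfl <;> simp

theorem AddMonoidHom.intUnits_smul_apply (ε : ℤˣ) (f : X →+ Y) (x : X) : (ε • f) x = ε • f x := by
  rcases Int.units_eq_one_or ε with rfl | rfl <;> simp

theorem AddSubgroup.intUnits_smul_mem (H : AddSubgroup X) (ε : ℤˣ) {x : X} (hx : x ∈ H) :
    ε • x ∈ H := by
  rcases Int.units_eq_one_or ε with rfl | rfl <;> simpa using hx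

theorem intUnits_smul_smul {R : Type*} [Ring R] [Module R X] (ε : ℤˣ) (r : R) (x : X) :
    (ε • r) • x = ε • (r • x) := by
  rcases Int.units_eq_one_or ε with rfl | rfl <;> simp

theorem intUnits_smul_mul {R : Type*} [Ring R] (ε : ℤˣ) (r s : R) :
    (ε • r) * s = ε • (r * s) := by
  rcases Int.units_eq_one_or ε with rfl | rfl <;> simp

theorem mul_intUnits_smul {R : Type*} [Ring R] (ε : ℤˣ) (r s : R) :
    r * (ε • s) = ε • (r * s) := by
  rcases Int.units_eq_one_or ε with rfl | rfl <;> simp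

theorem Int.negOnePow_smul_congr {a b : ℤ} (h : Even (a - b)) (x : X) :
    a.negOnePow • x = b.negOnePow • x := by
  rw [(Int.negOnePow_eq_iff a b).2 h]

theorem Int.negOnePow_smul_of_even {a : ℤ} (h : Even a) (x : X) : a.negOnePow • x = x := by
  rw [Int.negOnePow_even a h, one_smul]

theorem Int.negOnePow_smul_smul (a b : ℤ) (x : X) :
    a.negOnePow • b.negOnePow • x = (a + b).negOnePow • x := by
  rw [Int.negOnePow_add, mul_smul]

end UnitsSMul

/-! ### Graded abelian groups and their projections -/

section Grading

variable {X : Type*} [AddCommGroup X] (gr : ℤ → AddSubgroup X)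

/-- The projection of a graded abelian group onto one of its homogeneous components. -/
noncomputable def homogeneousProj [DirectSum.Decomposition gr] (i : ℤ) : X →+ X where
  toFun x := DirectSum.decompose gr x i
  map_zero' := by simp
  map_add' x y := by simp

section Proj

variable [DirectSum.Decomposition gr]

theorem homogeneousProj_mem (i : ℤ) (x : X) : homogeneousProj gr i x ∈ gr i :=
  (DirectSum.decompose gr x i).2

theorem homogeneousProj_of_mem {i : ℤ} {x : X} (hx : x ∈ gr i) : homogeneousProj gr i x = x :=
  DirectSum.decompose_of_mem_same gr hx

theorem homogeneousProj_of_ne {i j : ℤ} (h : i ≠ j) {x : X} (hx : x ∈ gr i) :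
    homogeneousProj gr j x = 0 :=
  DirectSum.decompose_of_mem_ne gr hx h

variable {gr}

variable (gr) in
@[elab_as_elim]
theorem homogeneous_induction {p : X → Prop} (x : X) (h : ∀ i, ∀ y ∈ gr i, p y)
    (hadd : ∀ y z, p y → p z → p (y + z)) : p x := by
  induction x using DirectSum.Decomposition.inductionOn gr with
  | zero => exact h 0 0 (zero_mem _)
  | add y z hy hz => exact hadd y z hy hz
  | homogeneous y => exact h _ y y.2

variable (gr) in
/-- The additive map given on the component of degree `i` by the restriction of `f i`. -/
noncomputable def gradedLift {Y : Type*} [AddCommGroup Y] (f : ℤ → X →+ Y) : X →+ Y :=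
  (DirectSum.toAddMonoid (fun i : ℤ => (f i).comp (gr i).subtype)).comp
    (DirectSum.decomposeAddEquiv gr).toAddMonoidHom

theorem gradedLift_of_mem {Y : Type*} [AddCommGroup Y] (f : ℤ → X →+ Y) {i : ℤ} {x : X}
    (hx : x ∈ gr i) : gradedLift gr f x = f i x := by
  lift x to gr i using hx
  simp [gradedLift, DirectSum.decompose_coe]

end Proj

/-- A grading can be given by a family of projections. -/
@[reducible]
noncomputable def decompositionOfProj (p : ℤ → X →+ X) (hp : ∀ i, ∀ x ∈ gr i, p i x = x)
    (hne : ∀ i j, i ≠ j → ∀ x ∈ gr i, p j x = 0) (hspan : ∀ x, x ∈ ⨆ i, gr i) :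
    DirectSum.Decomposition gr := by
  refine DirectSum.IsInternal.chooseDecomposition gr ⟨?_, ?_⟩
  · rw [injective_iff_map_eq_zero]
    intro s hs
    ext i
    have key : ∀ t, p i (DirectSum.coeAddMonoidHom gr t) = t i := by
      intro t
      refine DirectSum.induction_on t (by simp) (fun j x => ?_) (fun a b ha hb => ?_)
      · rw [DirectSum.coeAddMonoidHom_of]
        by_cases hij : j = i
        · subst hij
          rw [hp _ _ x.2, DirectSum.of_eq_same]
        · rw [hne _ _ hij _ x.2, DirectSum.of_eq_of_ne _ _ _ (Ne.symm hij)]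
          rfl
      · simp only [map_add, ha, hb, DirectSum.add_apply, AddSubgroup.coe_add]
    rw [← key, show DirectSum.coeAddMonoidHom gr s = 0 from hs, map_zero]
    rfl
  · intro x
    induction hspan x using AddSubgroup.iSup_induction' with
    | hp i x hx => exact ⟨DirectSum.of (fun i => gr i) i ⟨x, hx⟩, DirectSum.coeAddMonoidHom_of gr _ _⟩
    | h1 => exact ⟨0, map_zero _⟩
    | hadd x y _ _ hx hy =>
      obtain ⟨a, ha⟩ := hx
      obtain ⟨b, hb⟩ := hy
      exact ⟨a + b, by rw [← ha, ← hb]; exact map_add (DirectSum.coeAddMonoidHom gr) a b⟩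

end Grading

/-! ### Koszul signs as additive operators on `B` -/

namespace DGAlgebra

variable (B : DGAlgebra.{u})

/-- The map that multiplies each homogeneous element `b` of degree `i` by `(-1) ^ (i * j)`. -/
noncomputable def sgn (j : ℤ) : B →+ B :=
  gradedLift B.gr fun i => (i * j).negOnePow • AddMonoidHom.id B

variable {B}

theorem sgn_of_mem (j : ℤ) {i : ℤ} {b : B} (hb : b ∈ B.gr i) :
    B.sgn j b = (i * j).negOnePow • b := by
  simp [sgn, gradedLift_of_mem _ hb]

theorem sgn_mem (j : ℤ) {i : ℤ} {b : B} (hb : b ∈ B.gr i) : B.sgn j b ∈ B.gr i := by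
  rw [sgn_of_mem j hb]
  exact AddSubgroup.intUnits_smul_mem _ _ hb

theorem sgn_one (j : ℤ) : B.sgn j 1 = 1 := by
  rw [sgn_of_mem j B.one_mem_gr]
  simp

theorem sgn_sgn (j k : ℤ) (b : B) : B.sgn j (B.sgn k b) = B.sgn (j + k) b := by
  induction b using homogeneous_induction B.gr with
  | h i b hb =>
    rw [sgn_of_mem _ (sgn_mem k hb), sgn_of_mem _ hb, sgn_of_mem _ hb, Int.negOnePow_smul_smul,
      mul_add]
  | hadd x y hx hy => simp only [map_add, hx, hy]

theorem sgn_of_even {j : ℤ} (hj : Even j) (b : B) : B.sgn j b = b := by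
  induction b using homogeneous_induction B.gr with
  | h i b hb => rw [sgn_of_mem _ hb, Int.negOnePow_smul_of_even (hj.mul_left i)]
  | hadd x y hx hy => simp only [map_add, hx, hy]

@[simp]
theorem sgn_sgn_self (j : ℤ) (b : B) : B.sgn j (B.sgn j b) = b := by
  rw [sgn_sgn, sgn_of_even (Even.add_self j)]

theorem sgn_mul (j : ℤ) (a b : B) : B.sgn j (a * b) = B.sgn j a * B.sgn j b := by
  induction a using homogeneous_induction B.gr with
  | hadd x y hx hy => simp only [map_add, add_mul, hx, hy]
  | h i a ha =>
    induction b using homogeneous_induction B.gr with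
    | hadd x y hx hy => simp only [map_add, mul_add, hx, hy]
    | h k b hb =>
      rw [sgn_of_mem _ (B.mul_mem_gr ha hb), sgn_of_mem _ ha, sgn_of_mem _ hb,
        intUnits_smul_mul, mul_intUnits_smul, Int.negOnePow_smul_smul, add_mul]

theorem d_sgn (j : ℤ) (b : B) : B.d (B.sgn j b) = j.negOnePow • B.sgn j (B.d b) := by
  induction b using homogeneous_induction B.gr with
  | hadd x y hx hy => simp only [map_add, smul_add, hx, hy]
  | h i b hb =>
    rw [sgn_of_mem _ hb, sgn_of_mem _ (B.d_mem hb), AddMonoidHom.map_intUnits_smul,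
      Int.negOnePow_smul_smul]
    exact Int.negOnePow_smul_congr ⟨0, by ring⟩ _

theorem d_mul_eq (a b : B) : B.d (a * b) = B.d a * b + B.sgn 1 a * B.d b := by
  induction a using homogeneous_induction B.gr with
  | hadd x y hx hy => simp only [map_add, add_mul, hx, hy]; abel
  | h i a ha =>
    rw [B.d_mul ha, sgn_of_mem _ ha, intUnits_smul_mul, mul_one]

/-- The operator `sgn j` absorbs the sign of each component of `a`, so graded commutativity needs
only one homogeneous factor. -/
theorem mul_comm_of_mem {j : ℤ} (a : B) {b : B} (hb : b ∈ B.gr j) : a * b = b * B.sgn j a := by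
  induction a using homogeneous_induction B.gr with
  | hadd x y hx hy => simp only [map_add, add_mul, mul_add, hx, hy]
  | h i a ha =>
    rw [B.graded_comm ha hb, sgn_of_mem _ ha, mul_intUnits_smul]

end DGAlgebra

/-! ### Homology classes and quasi-isomorphisms in terms of elements -/

namespace DGModule

variable {B : DGAlgebra.{u}}

theorem d_smul_eq (M : DGModule.{u, v} B) (b : B) (m : M) :
    M.d (b • m) = B.d b • m + B.sgn 1 b • M.d m := by
  induction b using homogeneous_induction B.gr with
  | hadd x y hx hy => simp only [map_add, add_smul, hx, hy]; abel
  | h i b hb => rw [M.d_smul hb, DGAlgebra.sgn_of_mem _ hb, intUnits_smul_smul, mul_one]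

theorem smul_mem' (M : DGModule.{u, v} B) {i j k : ℤ} (h : i + j = k) {b : B} {m : M}
    (hb : b ∈ B.gr i) (hm : m ∈ M.gr j) : b • m ∈ M.gr k := h ▸ M.smul_mem hb hm

theorem d_mem' (M : DGModule.{u, v} B) {i j : ℤ} (h : j + 1 = i) {m : M}
    (hm : m ∈ M.gr i) : M.d m ∈ M.gr j := by
  have := M.d_mem hm
  rwa [← h, add_sub_cancel_right] at this

section Homology

variable (M : DGModule.{u, v} B) {i : ℤ}

/-- The homology class of a cycle. -/
def homologyMk (i : ℤ) : M.cycles i →ₗ[B.cyclesZero] M.homology i := (M.boundaries i).mkQ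

theorem homologyMk_surjective (i : ℤ) : Function.Surjective (M.homologyMk i) :=
  Submodule.mkQ_surjective _

theorem homologyMk_eq_zero {z : M.cycles i} :
    M.homologyMk i z = 0 ↔ ∃ m ∈ M.gr (i + 1), M.d m = z :=
  Submodule.Quotient.mk_eq_zero _

theorem subsingleton_homology_iff :
    Subsingleton (M.homology i) ↔
      ∀ z ∈ M.gr i, M.d z = 0 → ∃ w ∈ M.gr (i + 1), M.d w = z := by
  constructor
  · intro h z hz hdz
    exact (M.homologyMk_eq_zero (z := ⟨z, hz, hdz⟩)).1 (Subsingleton.elim _ _)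
  · intro h
    refine subsingleton_of_forall_eq 0 fun x => ?_
    obtain ⟨z, rfl⟩ := M.homologyMk_surjective i x
    exact M.homologyMk_eq_zero.2 (h z z.2.1 z.2.2)

end Homology

namespace Hom

variable {M : DGModule.{u, v} B} {N : DGModule.{u, w} B} (f : Hom M N) {i : ℤ}

theorem homologyMap_mk (z : M.cycles i) :
    f.homologyMap i (M.homologyMk i z) = N.homologyMk i (f.cyclesMap i z) := rfl

theorem homologyMap_injective_iff :
    Function.Injective (f.homologyMap i) ↔
      ∀ z ∈ M.gr i, M.d z = 0 → ∀ y ∈ N.gr (i + 1), N.d y = f.toLinearMap z →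
        ∃ w ∈ M.gr (i + 1), M.d w = z := by
  rw [injective_iff_map_eq_zero]
  constructor
  · intro h z hz hdz y hy hyz
    exact M.homologyMk_eq_zero.1 (h (M.homologyMk i ⟨z, hz, hdz⟩)
      (N.homologyMk_eq_zero.2 ⟨y, hy, hyz⟩))
  · intro h x hx
    obtain ⟨z, rfl⟩ := M.homologyMk_surjective i x
    rw [homologyMap_mk, homologyMk_eq_zero] at hx
    obtain ⟨y, hy, hyz⟩ := hx
    exact M.homologyMk_eq_zero.2 (h z z.2.1 z.2.2 y hy hyz)

theorem homologyMap_surjective_iff :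
    Function.Surjective (f.homologyMap i) ↔
      ∀ y ∈ N.gr i, N.d y = 0 → ∃ z ∈ M.gr i, M.d z = 0 ∧
        ∃ w ∈ N.gr (i + 1), N.d w = y - f.toLinearMap z := by
  constructor
  · intro h y hy hdy
    obtain ⟨x, hx⟩ := h (N.homologyMk i ⟨y, hy, hdy⟩)
    obtain ⟨z, rfl⟩ := M.homologyMk_surjective i x
    rw [homologyMap_mk, eq_comm, ← sub_eq_zero, ← map_sub, homologyMk_eq_zero] at hx
    exact ⟨z, z.2.1, z.2.2, hx⟩
  · intro h x
    obtain ⟨y, rfl⟩ := N.homologyMk_surjective i x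
    obtain ⟨z, hz, hdz, w, hw, hwy⟩ := h y y.2.1 y.2.2
    refine ⟨M.homologyMk i ⟨z, hz, hdz⟩, ?_⟩
    rw [homologyMap_mk, eq_comm, ← sub_eq_zero, ← map_sub, homologyMk_eq_zero]
    exact ⟨w, hw, hwy⟩

/-- Exactness of the mapping cone of a quasi-isomorphism. -/
theorem IsQuasiIso.exists_cone {f : Hom M N} (hf : f.IsQuasiIso) {x : M} {y : N}
    (hx : x ∈ M.gr i) (hy : y ∈ N.gr (i + 1)) (hdx : M.d x = 0)
    (hdy : N.d y = f.toLinearMap x) :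
    ∃ x' ∈ M.gr (i + 1), ∃ y' ∈ N.gr (i + 1 + 1), M.d x' = x ∧ N.d y' = y - f.toLinearMap x' := by
  -- Injectivity of `Hᵢ(f)` bounds `x` by some `x₁`. The cycle `y - f x₁` need not be a boundary,
  -- but surjectivity in degree `i + 1` makes it one after `x₁` is changed by a cycle.
  obtain ⟨x₁, hx₁, rfl⟩ := f.homologyMap_injective_iff.1 (hf i).1 x hx hdx y hy hdy
  obtain ⟨z, hz, hdz, w, hw, hwy⟩ := f.homologyMap_surjective_iff.1 (hf (i + 1)).2
    (y - f.toLinearMap x₁) (sub_mem hy (f.map_gr hx₁)) (by rw [map_sub, hdy, f.map_d, sub_self])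
  refine ⟨x₁ + z, add_mem hx₁ hz, w, hw, by rw [map_add, hdz, add_zero], ?_⟩
  rw [hwy, map_add, sub_sub]

/-- The identity morphism. -/
protected def id (M : DGModule.{u, v} B) : Hom M M where
  toLinearMap := LinearMap.id
  map_gr h := h
  map_d _ := rfl

/-- The composition of morphisms. -/
def comp {L : DGModule.{u, v} B} {M : DGModule.{u, v} B} {N : DGModule.{u, v} B}
    (g : Hom M N) (f : Hom L M) : Hom L N where
  toLinearMap := g.toLinearMap.comp f.toLinearMap
  map_gr h := g.map_gr (f.map_gr h)
  map_d m := by simp [f.map_d, g.map_d]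

theorem IsQuasiIso.comp {L M N : DGModule.{u, v} B} {g : Hom M N} {f : Hom L M}
    (hg : g.IsQuasiIso) (hf : f.IsQuasiIso) : (g.comp f).IsQuasiIso := by
  intro i
  have : ⇑((g.comp f).homologyMap i) = g.homologyMap i ∘ f.homologyMap i := by
    ext x
    obtain ⟨z, rfl⟩ := L.homologyMk_surjective i x
    rfl
  rw [this]
  exact (hg i).comp (hf i)

end Hom

end DGModule

/-! ### Tensor products over `B`: generators, functoriality and symmetry -/

namespace DGModule

open scoped TensorProduct

variable {B : DGAlgebra.{u}}

section TensorBasic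

variable (L : DGModule.{u, v} B) (N : DGModule.{u, w} B)

/-- The class of `x ⊗ y` in `L ⊗[B] N`. -/
def tmk : L →+ N →+ Tensor L N where
  toFun x :=
    { toFun := fun y => QuotientAddGroup.mk (x ⊗ₜ[ℤ] y)
      map_zero' := by simp
      map_add' := fun y z => by rw [TensorProduct.tmul_add]; rfl }
  map_zero' := by ext y; simp
  map_add' x y := by ext z; simp [TensorProduct.add_tmul]

variable {L N}

theorem tmk_intUnits_smul_left (ε : ℤˣ) (x : L) (y : N) :
    tmk L N (ε • x) y = ε • tmk L N x y := by
  rw [AddMonoidHom.map_intUnits_smul, AddMonoidHom.intUnits_smul_apply]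

/-- The defining relations are imposed for homogeneous `b` and `l`. They extend additively to all
`b`, while `l` stays homogeneous because the sign depends on its degree. -/
theorem tmk_sgn_smul {j : ℤ} {l : L} (hl : l ∈ L.gr j) (b : B) (n : N) :
    tmk L N (B.sgn j b • l) n = tmk L N l (b • n) := by
  induction b using homogeneous_induction B.gr with
  | hadd x y hx hy => simp only [map_add, add_smul, AddMonoidHom.add_apply, hx, hy]
  | h i b hb =>
    rw [DGAlgebra.sgn_of_mem _ hb, intUnits_smul_smul]
    refine QuotientAddGroup.eq.2 ?_
    rw [← neg_mem_iff]
    exact AddSubgroup.subset_closure ⟨i, j, b, l, n, hb, hl, by abel⟩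

theorem tmk_smul_right {j : ℤ} {l : L} (hl : l ∈ L.gr j) (b : B) (n : N) :
    tmk L N l (b • n) = tmk L N (B.sgn j b • l) n := (tmk_sgn_smul hl b n).symm

theorem tmk_smul_left {i j : ℤ} {b : B} {l : L} (hb : b ∈ B.gr i) (hl : l ∈ L.gr j) (n : N) :
    tmk L N (b • l) n = (i * j).negOnePow • tmk L N l (b • n) := by
  rw [tmk_smul_right hl, DGAlgebra.sgn_of_mem _ hb, intUnits_smul_smul,
    tmk_intUnits_smul_left, Int.negOnePow_smul_smul, Int.negOnePow_smul_of_even (Even.add_self _)]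

theorem tensorD_tmk {i : ℤ} {x : L} (hx : x ∈ L.gr i) (y : N) :
    tensorD L N (tmk L N x y) = tmk L N (L.d x) y + i.negOnePow • tmk L N x (N.d y) := by
  change QuotientAddGroup.mk (tensorDInt L N (x ⊗ₜ[ℤ] y)) = _
  rw [tensorDInt_tmul L N hx, QuotientAddGroup.mk_add]
  congr 1

theorem tmk_mem {i j n : ℤ} (h : i + j = n) {x : L} {y : N} (hx : x ∈ L.gr i) (hy : y ∈ N.gr j) :
    tmk L N x y ∈ tensorGr L N n :=
  AddSubgroup.subset_closure ⟨i, j, x, y, h, hx, hy, rfl⟩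

@[elab_as_elim]
theorem tensor_induction {p : Tensor L N → Prop} (z : Tensor L N)
    (h : ∀ i, ∀ x ∈ L.gr i, ∀ y, p (tmk L N x y)) (hadd : ∀ y z, p y → p z → p (y + z)) :
    p z := by
  obtain ⟨z, rfl⟩ := QuotientAddGroup.mk_surjective z
  induction z using TensorProduct.induction_on with
  | zero => simpa using h 0 0 (zero_mem _) 0
  | add y z hy hz => exact hadd _ _ hy hz
  | tmul x y =>
    induction x using homogeneous_induction L.gr with
    | h i x hx => exact h i x hx y
    | hadd x x' hx hx' =>
      have := hadd _ _ hx hx'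
      rwa [← QuotientAddGroup.mk_add, ← TensorProduct.add_tmul] at this

theorem map_tensorGr_le {X : Type*} [AddCommGroup X] (f : Tensor L N →+ X) (n : ℤ)
    (H : AddSubgroup X)
    (h : ∀ i j, i + j = n → ∀ x ∈ L.gr i, ∀ y ∈ N.gr j, f (tmk L N x y) ∈ H) :
    ∀ z ∈ tensorGr L N n, f z ∈ H := by
  change tensorGr L N n ≤ H.comap f
  rw [tensorGr, AddSubgroup.closure_le]
  rintro _ ⟨i, j, x, y, hij, hx, hy, rfl⟩
  exact h i j hij x hx y hy

theorem tensorD_mem {m n : ℤ} (hmn : m + 1 = n) {z : Tensor L N} (hz : z ∈ tensorGr L N n) :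
    tensorD L N z ∈ tensorGr L N m := by
  refine map_tensorGr_le _ n _ (fun i j hij x hx y hy => ?_) z hz
  rw [tensorD_tmk hx]
  exact add_mem (tmk_mem (by lia) (L.d_mem hx) hy)
    (AddSubgroup.intUnits_smul_mem _ _ (tmk_mem (by lia) hx (N.d_mem hy)))

theorem tensorD_tensorD (z : Tensor L N) : tensorD L N (tensorD L N z) = 0 := by
  induction z using tensor_induction with
  | hadd y z hy hz => rw [map_add, map_add, hy, hz, add_zero]
  | h i x hx y =>
    rw [tensorD_tmk hx, map_add, AddMonoidHom.map_intUnits_smul, tensorD_tmk (L.d_mem hx),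
      tensorD_tmk hx, L.d_d, N.d_d, Int.negOnePow_sub]
    rcases Int.units_eq_one_or i.negOnePow with h | h <;> simp [h]

/-- Additive maps out of `L ⊗[B] N` are balanced biadditive maps. -/
noncomputable def tensorLift {X : Type*} [AddCommGroup X] (φ : L →+ N →+ X)
    (h : ∀ j, ∀ l ∈ L.gr j, ∀ (b : B) (n : N), φ (B.sgn j b • l) n = φ l (b • n)) :
    Tensor L N →+ X :=
  QuotientAddGroup.lift _ (TensorProduct.liftAddHom φ fun r m n => by simp) (by
    rw [tensorRelations, AddSubgroup.closure_le]
    rintro _ ⟨i, j, b, l, n, hb, hl, rfl⟩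
    have := h j l hl b n
    rw [DGAlgebra.sgn_of_mem _ hb, intUnits_smul_smul] at this
    simp only [SetLike.mem_coe, AddMonoidHom.mem_ker, map_sub, TensorProduct.liftAddHom_tmul]
    rw [this, sub_self])

@[simp]
theorem tensorLift_tmk {X : Type*} [AddCommGroup X] (φ : L →+ N →+ X)
    (h : ∀ j, ∀ l ∈ L.gr j, ∀ (b : B) (n : N), φ (B.sgn j b • l) n = φ l (b • n)) (x : L) (y : N) :
    tensorLift φ h (tmk L N x y) = φ x y := rfl

theorem subsingleton_tensorHomology_iff {n : ℤ} :
    Subsingleton (tensorHomology L N n) ↔ ∀ z ∈ tensorGr L N n, tensorD L N z = 0 →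
      ∃ w ∈ tensorGr L N (n + 1), tensorD L N w = z := by
  rw [QuotientAddGroup.subsingleton_iff, AddSubgroup.addSubgroupOf_eq_top]
  constructor
  · intro h z hz hdz
    exact h ⟨hz, hdz⟩
  · intro h z hz
    exact h z hz.1 hz.2

end TensorBasic

section Functoriality

variable {L : DGModule.{u, v} B} {L' : DGModule.{u, t} B}

/-- The map `L ⊗[B] N → L' ⊗[B] N` induced by a homogeneous linear map of degree zero. -/
noncomputable def tensorMap (f : L →ₗ[B] L') (hf : ∀ i, ∀ x ∈ L.gr i, f x ∈ L'.gr i)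
    (N : DGModule.{u, w} B) : Tensor L N →+ Tensor L' N :=
  tensorLift ((tmk L' N).comp f.toAddMonoidHom) fun j l hl b n => by
    simpa using tmk_sgn_smul (hf j l hl) b n

variable {N : DGModule.{u, w} B}

theorem tensorMap_mem (f : L →ₗ[B] L') (hf : ∀ i, ∀ x ∈ L.gr i, f x ∈ L'.gr i) {n : ℤ}
    {z : Tensor L N} (hz : z ∈ tensorGr L N n) : tensorMap f hf N z ∈ tensorGr L' N n :=
  map_tensorGr_le _ n _ (fun _ _ hij x hx _ hy => tmk_mem hij (hf _ x hx) hy) z hz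

namespace Hom

/-- The map `f ⊗ N`. -/
noncomputable def tensor (f : Hom L L') (N : DGModule.{u, w} B) : Tensor L N →+ Tensor L' N :=
  tensorMap f.toLinearMap (fun _ _ => f.map_gr) N

@[simp]
theorem tensor_tmk (f : Hom L L') (x : L) (y : N) :
    f.tensor N (tmk L N x y) = tmk L' N (f.toLinearMap x) y := rfl

theorem tensor_mem (f : Hom L L') {n : ℤ} {z : Tensor L N} (hz : z ∈ tensorGr L N n) :
    f.tensor N z ∈ tensorGr L' N n := tensorMap_mem _ _ hz

theorem tensor_d (f : Hom L L') (z : Tensor L N) :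
    f.tensor N (tensorD L N z) = tensorD L' N (f.tensor N z) := by
  induction z using tensor_induction with
  | hadd y z hy hz => simp only [map_add, hy, hz]
  | h i x hx y =>
    rw [tensorD_tmk hx, map_add, AddMonoidHom.map_intUnits_smul, tensor_tmk, tensor_tmk,
      tensor_tmk, tensorD_tmk (f.map_gr hx), f.map_d]

end Hom

end Functoriality

section Swap

variable (L : DGModule.{u, v} B) (N : DGModule.{u, w} B)

/-- The map that multiplies each homogeneous element `x` of degree `i` by `(-1) ^ (i * j)`. -/
noncomputable def sgn (j : ℤ) : L →+ L :=
  gradedLift L.gr fun i => (i * j).negOnePow • AddMonoidHom.id L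

variable {L}

theorem sgn_of_mem (j : ℤ) {i : ℤ} {x : L} (hx : x ∈ L.gr i) :
    L.sgn j x = (i * j).negOnePow • x := by
  simp [sgn, gradedLift_of_mem _ hx]

variable (L)

/-- The symmetry `L ⊗[B] N → N ⊗[B] L`, `x ⊗ y ↦ (-1) ^ (|x| * |y|) • y ⊗ x`. -/
noncomputable def tensorSwap : Tensor L N →+ Tensor N L :=
  tensorLift (gradedLift L.gr fun j => ((tmk N L).comp (N.sgn j)).flip) fun j l hl b n => by
    rw [gradedLift_of_mem _ hl]
    induction b using homogeneous_induction B.gr with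
    | hadd x y hx hy => simp only [map_add, add_smul, AddMonoidHom.add_apply, hx, hy]
    | h i b hb =>
      rw [DGAlgebra.sgn_of_mem _ hb, intUnits_smul_smul, AddMonoidHom.map_intUnits_smul,
        gradedLift_of_mem _ (L.smul_mem hb hl)]
      induction n using homogeneous_induction N.gr with
      | hadd x y hx hy => simp only [map_add, smul_add, hx, hy]
      | h k n hn =>
        simp only [AddMonoidHom.intUnits_smul_apply, AddMonoidHom.flip_apply,
          AddMonoidHom.comp_apply]
        rw [sgn_of_mem _ hn, sgn_of_mem _ (N.smul_mem hb hn), tmk_intUnits_smul_left,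
          tmk_intUnits_smul_left, tmk_smul_left hb hn, Int.negOnePow_smul_smul,
          Int.negOnePow_smul_smul]
        exact Int.negOnePow_smul_congr ⟨0, by ring⟩ _

variable {L N}

theorem tensorSwap_tmk {i j : ℤ} {x : L} {y : N} (hx : x ∈ L.gr i) (hy : y ∈ N.gr j) :
    tensorSwap L N (tmk L N x y) = (i * j).negOnePow • tmk N L y x := by
  rw [tensorSwap, tensorLift_tmk, gradedLift_of_mem _ hx, AddMonoidHom.flip_apply,
    AddMonoidHom.comp_apply, sgn_of_mem _ hy, tmk_intUnits_smul_left, mul_comm]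

@[elab_as_elim]
theorem tensor_induction_homogeneous {p : Tensor L N → Prop} (z : Tensor L N)
    (h : ∀ i j, ∀ x ∈ L.gr i, ∀ y ∈ N.gr j, p (tmk L N x y))
    (hadd : ∀ y z, p y → p z → p (y + z)) : p z := by
  induction z using tensor_induction with
  | hadd y z hy hz => exact hadd y z hy hz
  | h i x hx y =>
    induction y using homogeneous_induction N.gr with
    | h j y hy => exact h i j x hx y hy
    | hadd y y' hy hy' => rw [map_add]; exact hadd _ _ hy hy'

theorem tensorSwap_tensorSwap (z : Tensor L N) : tensorSwap N L (tensorSwap L N z) = z := by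
  induction z using tensor_induction_homogeneous with
  | hadd y z hy hz => rw [map_add, map_add, hy, hz]
  | h i j x hx y hy =>
    rw [tensorSwap_tmk hx hy, AddMonoidHom.map_intUnits_smul, tensorSwap_tmk hy hx,
      Int.negOnePow_smul_smul, Int.negOnePow_smul_of_even ⟨i * j, by ring⟩]

theorem tensorSwap_mem {n : ℤ} {z : Tensor L N} (hz : z ∈ tensorGr L N n) :
    tensorSwap L N z ∈ tensorGr N L n := by
  refine map_tensorGr_le _ n _ (fun i j hij x hx y hy => ?_) z hz
  rw [tensorSwap_tmk hx hy]
  exact AddSubgroup.intUnits_smul_mem _ _ (tmk_mem (by lia) hy hx)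

theorem tensorSwap_d (z : Tensor L N) :
    tensorSwap L N (tensorD L N z) = tensorD N L (tensorSwap L N z) := by
  induction z using tensor_induction_homogeneous with
  | hadd y z hy hz => simp only [map_add, hy, hz]
  | h i j x hx y hy =>
    rw [tensorSwap_tmk hx hy, tensorD_tmk hx, map_add, AddMonoidHom.map_intUnits_smul,
      AddMonoidHom.map_intUnits_smul, tensorSwap_tmk (L.d_mem hx) hy,
      tensorSwap_tmk hx (N.d_mem hy), tensorD_tmk hy, smul_add, Int.negOnePow_smul_smul,
      Int.negOnePow_smul_smul, add_comm]
    congr 1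
    · exact Int.negOnePow_smul_congr ⟨0, by ring⟩ _
    · exact Int.negOnePow_smul_congr ⟨-j, by ring⟩ _

/-- `Tor` resolves its second argument; the symmetry makes it possible to argue along a semibasis of
the first argument instead. -/
theorem subsingleton_tensorHomology_swap {n : ℤ} (h : Subsingleton (tensorHomology N L n)) :
    Subsingleton (tensorHomology L N n) := by
  rw [subsingleton_tensorHomology_iff] at h ⊢
  intro z hz hdz
  obtain ⟨w, hw, hwz⟩ := h _ (tensorSwap_mem hz) (by rw [← tensorSwap_d, hdz, map_zero])
  exact ⟨tensorSwap N L w, tensorSwap_mem hw, by rw [← tensorSwap_d, hwz, tensorSwap_tensorSwap]⟩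

end Swap

end DGModule

/-! ### Dévissage along semibases and coordinates in tensor products -/

/-- An element-wise dévissage of exactness along a well-ordered family of coordinates. -/
theorem exists_eq_of_coord_exact {ι X : Type*} [LinearOrder ι] [WellFoundedLT ι] [AddCommGroup X]
    {A : ι → Type*} [∀ e, AddCommGroup (A e)] (coord : ∀ e, X →+ A e)
    (hfin : ∀ x, {e | coord e x ≠ 0}.Finite) (hinj : ∀ x, (∀ e, coord e x = 0) → x = 0)
    (D : X →+ X) (hDD : ∀ x, D (D x) = 0) (Z W : AddSubgroup X) (hDW : ∀ w ∈ W, D w ∈ Z)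
    (hstep : ∀ e, ∀ z ∈ Z, D z = 0 → (∀ e' > e, coord e' z = 0) →
      ∃ w ∈ W, coord e (D w) = coord e z ∧ ∀ e' > e, coord e' (D w) = 0)
    {z : X} (hz : z ∈ Z) (hdz : D z = 0) : ∃ w ∈ W, D w = z := by
  -- Well-founded induction on a bound `e` for the support of `z`. After `hstep` clears the
  -- coordinate at `e`, the remainder has finite support strictly below `e`, and the largest index
  -- `m` of that support is the next bound.
  have key : ∀ e, ∀ z ∈ Z, D z = 0 → (∀ e' > e, coord e' z = 0) → ∃ w ∈ W, D w = z := by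
    intro e
    induction e using WellFoundedLT.induction with
    | ind e ih =>
      intro z hz hdz hez
      obtain ⟨w, hw, hwe, hwe'⟩ := hstep e z hz hdz hez
      have hz' : z - D w ∈ Z := sub_mem hz (hDW w hw)
      have hdz' : D (z - D w) = 0 := by rw [map_sub, hdz, hDD, sub_zero]
      have hle : ∀ e', e ≤ e' → coord e' (z - D w) = 0 := by
        intro e' he'
        rcases he'.eq_or_lt with rfl | he'
        · rw [map_sub, hwe, sub_self]
        · rw [map_sub, hez e' he', hwe' e' he', sub_zero]
      by_cases h0 : z - D w = 0
      · exact ⟨w, hw, (sub_eq_zero.1 h0).symm⟩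
      have hne : (hfin (z - D w)).toFinset.Nonempty := by
        by_contra hne
        refine h0 (hinj _ fun e' => ?_)
        by_contra he'
        exact hne ⟨e', by simpa using he'⟩
      obtain ⟨m, hm, hmax⟩ := (hfin (z - D w)).toFinset.exists_max_image id hne
      have hme : m < e := by
        by_contra hme
        exact (by simpa using hm : coord m (z - D w) ≠ 0) (hle m (not_lt.1 hme))
      obtain ⟨w', hw', hww'⟩ := ih m hme (z - D w) hz' hdz' fun e' he' => by
        by_contra hne'
        exact absurd (hmax e' (by simpa using hne')) (not_le.2 he')
      exact ⟨w + w', add_mem hw hw', by rw [map_add, hww']; abel⟩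
  by_cases hne : (hfin z).toFinset.Nonempty
  · obtain ⟨m, hm, hmax⟩ := (hfin z).toFinset.exists_max_image id hne
    refine key m z hz hdz fun e' he' => ?_
    by_contra hne'
    exact absurd (hmax e' (by simpa using hne')) (not_le.2 he')
  · refine ⟨0, zero_mem _, ?_⟩
    rw [map_zero, eq_comm]
    refine hinj z fun e' => ?_
    by_contra he'
    exact hne ⟨e', by simpa using he'⟩

namespace DGModule

variable {B : DGAlgebra.{u}}

/-- A semibasis, as a basis indexed by a linearly ordered type. -/
structure OrderedBasis (F : DGModule.{u, v} B) (ι : Type w) [LinearOrder ι] where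
  basis : Module.Basis ι B F
  deg : ι → ℤ
  mem : ∀ e, basis e ∈ F.gr (deg e)
  repr_d : ∀ e e', e ≤ e' → basis.repr (F.d (basis e)) e' = 0

theorem IsSemibasis.exists_orderedBasis {F : DGModule.{u, v} B} {S : Set F} {r : S → S → Prop}
    (h : F.IsSemibasis S r) :
    ∃ (_ : LinearOrder S) (_ : WellFoundedLT S), Nonempty (OrderedBasis F S) := by
  have := h.isWellOrder
  classical
  let o : LinearOrder S := linearOrderOfSTO r
  refine ⟨o, ⟨this.wf⟩, ?_⟩
  choose deg hdeg using fun f : S => h.homogeneous f f.2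
  let b : Module.Basis S B F := Module.Basis.mk h.linearIndependent (by
    rw [Subtype.range_coe, h.span_eq_top])
  have hb : ∀ e, b e = e := fun e => Module.Basis.mk_apply _ _ e
  refine ⟨⟨b, deg, fun e => by rw [hb]; exact hdeg e, fun e e' hee' => ?_⟩⟩
  have hd := h.d_mem_span e
  have hset : {x : F | ∃ e' : S, r e' e ∧ (e' : F) = x} = b '' Set.Iio e := by
    ext x
    constructor
    · rintro ⟨e', he', rfl⟩
      exact ⟨e', he', hb e'⟩
    · rintro ⟨e', he', rfl⟩
      exact ⟨e', he', (hb e').symm⟩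
  rw [hset, b.mem_span_image] at hd
  rw [hb]
  by_contra hne
  exact absurd (hd (Finsupp.mem_support_iff.2 hne)) (not_lt.2 hee')

/-- A semibasis is a set of elements, so the order of `ι` has to be carried along the bijection with
the range of the basis. Over the zero ring a basis need not be injective. -/
theorem OrderedBasis.isSemibasis [Nontrivial B] {F : DGModule.{u, v} B} {ι : Type w}
    [LinearOrder ι] [WellFoundedLT ι] (E : OrderedBasis F ι) :
    F.IsSemibasis (Set.range E.basis) (fun x y =>
      (Equiv.ofInjective _ E.basis.injective).symm x <
        (Equiv.ofInjective _ E.basis.injective).symm y) := by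
  set φ := Equiv.ofInjective _ E.basis.injective
  refine ⟨?_, ?_, ?_, E.basis.span_eq, ?_⟩
  · exact RelEmbedding.isWellOrder (⟨φ.symm.toEmbedding, Iff.rfl⟩ :
      (fun x y : Set.range E.basis => φ.symm x < φ.symm y) ↪r ((· < ·) : ι → ι → Prop))
  · rintro _ ⟨e, rfl⟩
    exact ⟨_, E.mem e⟩
  · have := E.basis.linearIndependent.comp φ.symm φ.symm.injective
    convert this using 1
    ext x
    obtain ⟨e, rfl⟩ := φ.surjective x
    simp [φ]
  · intro f
    obtain ⟨e, rfl⟩ := φ.surjective f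
    have hset : {x : F | ∃ e' : Set.range E.basis, φ.symm e' < φ.symm (φ e) ∧ (e' : F) = x} =
        E.basis '' Set.Iio e := by
      ext x
      constructor
      · rintro ⟨e', he', rfl⟩
        obtain ⟨e', rfl⟩ := φ.surjective e'
        exact ⟨e', by simpa using he', rfl⟩
      · rintro ⟨e', he', rfl⟩
        exact ⟨φ e', by simpa using he', rfl⟩
    rw [hset, E.basis.mem_span_image]
    intro e' he'
    by_contra hlt
    exact Finsupp.mem_support_iff.1 he' (E.repr_d e e' (not_lt.1 hlt))

theorem OrderedBasis.isSemifree [Nontrivial B] {F : DGModule.{u, v} B} {ι : Type w}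
    [LinearOrder ι] [WellFoundedLT ι] (E : OrderedBasis F ι) : F.IsSemifree :=
  ⟨_, _, E.isSemibasis⟩

theorem OrderedBasis.isFiniteSemifree [Nontrivial B] {F : DGModule.{u, v} B} {ι : Type w}
    [LinearOrder ι] [Finite ι] (E : OrderedBasis F ι) : F.IsFiniteSemifree :=
  ⟨_, _, Set.finite_range _, E.isSemibasis⟩

namespace OrderedBasis

variable {G : DGModule.{u, v} B} {ι : Type w} [LinearOrder ι] (E : OrderedBasis G ι)

/-- The generators are homogeneous, so projections can be computed coordinatewise. This is how
homogeneity of an element is passed to its coordinates. -/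
theorem repr_homogeneousProj (i : ℤ) (g : G) (e : ι) :
    E.basis.repr (homogeneousProj G.gr i g) e =
      homogeneousProj B.gr (i - E.deg e) (E.basis.repr g e) := by
  obtain ⟨s, rfl⟩ := E.basis.repr.symm.surjective g
  induction s using Finsupp.induction_linear with
  | zero => simp
  | add s t hs ht => simp only [map_add, Finsupp.add_apply, hs, ht]
  | single e' b =>
    induction b using homogeneous_induction B.gr with
    | hadd x y hx hy => simp only [Finsupp.single_add, map_add, Finsupp.add_apply, hx, hy]
    | h k b hb =>
      rw [LinearEquiv.apply_symm_apply, Module.Basis.repr_symm_single]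
      have hm : b • E.basis e' ∈ G.gr (k + E.deg e') := G.smul_mem hb (E.mem e')
      by_cases hi : k + E.deg e' = i
      · rw [hi] at hm
        rw [homogeneousProj_of_mem _ hm]
        by_cases he : e' = e
        · subst he
          rw [homogeneousProj_of_mem _ (by simpa [show i - E.deg e' = k by lia] using hb)]
          simp
        · simp [he]
      · rw [homogeneousProj_of_ne _ hi hm]
        by_cases he : e' = e
        · subst he
          rw [homogeneousProj_of_ne _ (i := k) (by lia) (by simpa using hb)]
          simp
        · simp [he]

theorem repr_mem {i : ℤ} {g : G} (hg : g ∈ G.gr i) (e : ι) :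
    E.basis.repr g e ∈ B.gr (i - E.deg e) := by
  rw [← homogeneousProj_of_mem _ hg, repr_homogeneousProj]
  exact homogeneousProj_mem _ _ _

end OrderedBasis

section RightMul

variable (L : DGModule.{u, v} B)

/-- The right multiplication `(l, b) ↦ (-1) ^ (|l| * |b|) • b • l`. -/
noncomputable def rightMul : L →+ B →+ L :=
  gradedLift L.gr fun j => ((smulAddHom B L).comp (B.sgn j)).flip

variable {L}

theorem rightMul_of_mem {j : ℤ} {l : L} (hl : l ∈ L.gr j) (b : B) :
    L.rightMul l b = B.sgn j b • l := by
  rw [rightMul, gradedLift_of_mem _ hl]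
  rfl

theorem rightMul_one (l : L) : L.rightMul l 1 = l := by
  induction l using homogeneous_induction L.gr with
  | h i l hl => rw [rightMul_of_mem hl, DGAlgebra.sgn_one, one_smul]
  | hadd x y hx hy => rw [map_add, AddMonoidHom.add_apply, hx, hy]

/-- The sign of moving `c` across `b` cancels the sign from the change of degree between `l` and `l
· b`. This associativity is what makes the coordinates on `L ⊗[B] G` balanced. -/
theorem rightMul_mul {i j : ℤ} {l : L} (hl : l ∈ L.gr j) {b : B} (hb : b ∈ B.gr i) (c : B) :
    L.rightMul (B.sgn j b • l) c = L.rightMul l (b * c) := by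
  rw [rightMul_of_mem hl, DGAlgebra.sgn_mul, rightMul_of_mem (L.smul_mem (DGAlgebra.sgn_mem j hb) hl),
    smul_smul, ← sub_eq_zero, ← sub_smul]
  have := DGAlgebra.mul_comm_of_mem (B.sgn (i + j) c) (DGAlgebra.sgn_mem j hb)
  rw [this, DGAlgebra.sgn_sgn, show i + (i + j) = 2 * i + j by ring, ← DGAlgebra.sgn_sgn,
    DGAlgebra.sgn_of_even (even_two_mul i), sub_self, zero_smul]

theorem map_rightMul {L' : DGModule.{u, w} B} (f : Hom L L') (l : L) (b : B) :
    f.toLinearMap (L.rightMul l b) = L'.rightMul (f.toLinearMap l) b := by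
  induction l using homogeneous_induction L.gr with
  | h i l hl => rw [rightMul_of_mem hl, rightMul_of_mem (f.map_gr hl), map_smul]
  | hadd x y hx hy => simp only [map_add, AddMonoidHom.add_apply, hx, hy]

theorem rightMul_mem {i j k : ℤ} (h : i + j = k) {l : L} {b : B} (hb : b ∈ B.gr i)
    (hl : l ∈ L.gr j) : L.rightMul l b ∈ L.gr k := by
  rw [rightMul_of_mem hl]
  exact L.smul_mem' h (DGAlgebra.sgn_mem j hb) hl

end RightMul

namespace OrderedBasis

variable (L : DGModule.{u, v} B) {G : DGModule.{u, w} B} {ι : Type t} [LinearOrder ι]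
  (E : OrderedBasis G ι)

/-- The coordinates of the elements of `L ⊗[B] G` with respect to a basis of `G`. -/
noncomputable def tensorCoord : Tensor L G →+ ι →₀ L :=
  tensorLift
    (AddMonoidHom.mk' (fun l => (Finsupp.mapRange.addMonoidHom (L.rightMul l)).comp
      E.basis.repr.toLinearMap.toAddMonoidHom) fun l l' => by ext; simp)
    fun j l hl b n => by
      induction b using homogeneous_induction B.gr with
      | hadd x y hx hy => simp only [map_add, add_smul, AddMonoidHom.add_apply, hx, hy]
      | h i b hb =>
        ext e
        simp [rightMul_mul hl hb]

variable {L}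

theorem tensorCoord_tmk (l : L) (g : G) (e : ι) :
    E.tensorCoord L (tmk L G l g) e = L.rightMul l (E.basis.repr g e) := rfl

theorem tensorCoord_mem {n : ℤ} {z : Tensor L G} (hz : z ∈ tensorGr L G n) (e : ι) :
    E.tensorCoord L z e ∈ L.gr (n - E.deg e) := by
  refine map_tensorGr_le ((Finsupp.applyAddHom e).comp (E.tensorCoord L)) n _
    (fun i j hij l hl g hg => ?_) z hz
  exact rightMul_mem (by lia) (E.repr_mem hg e) hl

theorem tensorCoord_tmk_basis (l : L) (e : ι) :
    E.tensorCoord L (tmk L G l (E.basis e)) = Finsupp.single e l := by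
  ext e'
  rw [tensorCoord_tmk, Module.Basis.repr_self]
  by_cases h : e = e'
  · subst h
    simp [rightMul_one]
  · simp [h]

variable (L) in
/-- The element of `L ⊗[B] G` with given coordinates. -/
noncomputable def tensorOfCoord : (ι →₀ L) →+ Tensor L G :=
  Finsupp.liftAddHom fun e => (tmk L G).flip (E.basis e)

theorem tensorOfCoord_single (e : ι) (l : L) :
    E.tensorOfCoord L (Finsupp.single e l) = tmk L G l (E.basis e) := by
  simp [tensorOfCoord]

theorem tensorOfCoord_tensorCoord (z : Tensor L G) :
    E.tensorOfCoord L (E.tensorCoord L z) = z := by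
  induction z using tensor_induction with
  | hadd y z hy hz => rw [map_add, map_add, hy, hz]
  | h i l hl g =>
    obtain ⟨s, rfl⟩ := E.basis.repr.symm.surjective g
    induction s using Finsupp.induction_linear with
    | zero => simp
    | add s t hs ht => simp only [map_add, hs, ht]
    | single e b =>
      rw [Module.Basis.repr_symm_single, tmk_smul_right hl, tensorCoord_tmk_basis,
        tensorOfCoord_single]

/-- The differential of `L ⊗[B] G` acts on the leading coordinate through the differential
of `L`. -/
theorem tensorCoord_d_of_le {e : ι} {z : Tensor L G} (hz : ∀ e' > e, E.tensorCoord L z e' = 0)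
    {e' : ι} (he' : e ≤ e') :
    E.tensorCoord L (tensorD L G z) e' = L.d (E.tensorCoord L z e') := by
  rw [← E.tensorOfCoord_tensorCoord z]
  generalize E.tensorCoord L z = s at hz
  have hs : ∀ e'' ∈ s.support, e'' ≤ e' := fun e'' h => by
    by_contra hlt
    exact Finsupp.mem_support_iff.1 h (hz e'' (lt_of_le_of_lt he' (not_le.1 hlt)))
  clear hz
  induction s using Finsupp.induction with
  | zero => simp
  | single_add a l s has hl ih =>
    rw [Finsupp.support_single_add has hl] at hs
    simp only [map_add, Finsupp.add_apply, ih fun e'' h => hs e'' (Finset.mem_cons.2 (Or.inr h))]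
    congr 1
    rw [tensorOfCoord_single]
    have ha : a ≤ e' := hs a (Finset.mem_cons_self _ _)
    clear hs ih hl has
    induction l using homogeneous_induction L.gr with
    | hadd x y hx hy => simp only [map_add, AddMonoidHom.add_apply, Finsupp.add_apply, hx, hy]
    | h i l hl =>
      rw [tensorD_tmk hl, map_add, AddMonoidHom.map_intUnits_smul, tensorCoord_tmk_basis,
        tensorCoord_tmk_basis]
      -- The boundary of the generator `a` involves only generators before `a`, and `a ≤ e'`.
      have : E.tensorCoord L (tmk L G l (G.d (E.basis a))) e' = 0 := by
        rw [tensorCoord_tmk, E.repr_d a e' ha, map_zero]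
      have h2 : (i.negOnePow • E.tensorCoord L (tmk L G l (G.d (E.basis a)))) e' = 0 := by
        rcases Int.units_eq_one_or i.negOnePow with h | h <;> simp [h, this]
      rw [Finsupp.add_apply, h2, add_zero]
      by_cases hae : a = e'
      · subst hae
        simp
      · simp [hae]

theorem tensorCoord_map {L' : DGModule.{u, v} B} (f : Hom L L') (z : Tensor L G) (e : ι) :
    E.tensorCoord L' (f.tensor G z) e = f.toLinearMap (E.tensorCoord L z e) := by
  induction z using tensor_induction with
  | hadd y z hy hz => simp only [map_add, Finsupp.add_apply, hy, hz]
  | h i l hl g => rw [Hom.tensor_tmk, tensorCoord_tmk, tensorCoord_tmk, map_rightMul]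

theorem eq_zero_of_tensorCoord {z : Tensor L G} (hz : ∀ e, E.tensorCoord L z e = 0) : z = 0 := by
  rw [← E.tensorOfCoord_tensorCoord z, Finsupp.ext hz (g := 0), map_zero]

theorem finite_tensorCoord (z : Tensor L G) : {e | E.tensorCoord L z e ≠ 0}.Finite :=
  (E.tensorCoord L z).support.finite_toSet.subset fun e he => by simpa using he

end OrderedBasis

namespace OrderedBasis

variable {L : DGModule.{u, v} B} {G : DGModule.{u, w} B} {ι : Type t} [LinearOrder ι] [WellFoundedLT ι]

/-- Vanishing of the homology of `L ⊗[B] G` in one degree. -/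
theorem subsingleton_tensorHomology (E : OrderedBasis G ι) {i : ℤ}
    (h : ∀ e, Subsingleton (L.homology (i - E.deg e))) :
    Subsingleton (tensorHomology L G i) := by
  rw [subsingleton_tensorHomology_iff]
  intro z hz hdz
  let coord (e : ι) : Tensor L G →+ L := (Finsupp.applyAddHom e).comp (E.tensorCoord L)
  have hcoord : ∀ e z, coord e z = E.tensorCoord L z e := fun _ _ => rfl
  refine exists_eq_of_coord_exact coord E.finite_tensorCoord (fun z hz => E.eq_zero_of_tensorCoord hz) (tensorD L G) tensorD_tensorD
    (tensorGr L G i) (tensorGr L G (i + 1)) (fun w hw => tensorD_mem rfl hw) ?_ hz hdz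
  intro e z hz hdz he
  -- As the later coordinates vanish, the coordinate at `e` is a cycle of `L`, hence equal to some
  -- `d l`; the correction is `l ⊗ e`.
  obtain ⟨l, hl, hdl⟩ := subsingleton_homology_iff L |>.1 (h e) _ (E.tensorCoord_mem hz e) (by
    rw [← E.tensorCoord_d_of_le he le_rfl, hdz, map_zero, Finsupp.zero_apply])
  have hle : ∀ e' > e, E.tensorCoord L (tmk L G l (E.basis e)) e' = 0 := fun e' he' => by
    rw [tensorCoord_tmk_basis, Finsupp.single_eq_of_ne he'.ne']
  refine ⟨tmk L G l (E.basis e), tmk_mem (by ring) hl (E.mem e), ?_, fun e' he' => ?_⟩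
  · rw [hcoord, hcoord, E.tensorCoord_d_of_le hle le_rfl, tensorCoord_tmk_basis, Finsupp.single_eq_same, hdl]
  · rw [hcoord, E.tensorCoord_d_of_le hle he'.le, hle e' he', map_zero]

/-- Exactness of the mapping cone of `f ⊗ G` for a quasi-isomorphism `f`. -/
theorem exists_tensor_cone (E : OrderedBasis G ι) {L' : DGModule.{u, v} B} {f : Hom L L'} (hf : f.IsQuasiIso) {i : ℤ}
    {x : Tensor L G} {y : Tensor L' G} (hx : x ∈ tensorGr L G i)
    (hy : y ∈ tensorGr L' G (i + 1)) (hdx : tensorD L G x = 0)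
    (hdy : tensorD L' G y = f.tensor G x) :
    ∃ x' ∈ tensorGr L G (i + 1), ∃ y' ∈ tensorGr L' G (i + 1 + 1),
      tensorD L G x' = x ∧ tensorD L' G y' = y - f.tensor G x' := by
  -- The differential of the mapping cone of `f ⊗ G`. The sign on the first component makes its
  -- square zero; `hD'` undoes that sign so that `exists_cone` applies to the leading coordinates.
  let D : Tensor L G × Tensor L' G →+ Tensor L G × Tensor L' G :=
    AddMonoidHom.prod (-(tensorD L G).comp (AddMonoidHom.fst _ _))
      ((tensorD L' G).comp (AddMonoidHom.snd _ _) - (f.tensor G).comp (AddMonoidHom.fst _ _))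
  have hD : ∀ x y, D (x, y) = (-tensorD L G x, tensorD L' G y - f.tensor G x) := fun _ _ => rfl
  have hD' : ∀ x y, D (-x, y) = (tensorD L G x, tensorD L' G y + f.tensor G x) := fun x y => by
    rw [hD, map_neg, map_neg, neg_neg, sub_neg_eq_add]
  let coord (e : ι) : Tensor L G × Tensor L' G →+ L × L' :=
    ((Finsupp.applyAddHom e).comp (E.tensorCoord L)).prodMap
      ((Finsupp.applyAddHom e).comp (E.tensorCoord L'))
  have hcoord : ∀ e x y, coord e (x, y) = (E.tensorCoord L x e, E.tensorCoord L' y e) :=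
    fun _ _ _ => rfl
  have key : ∃ w ∈ (tensorGr L G (i + 1)).prod (tensorGr L' G (i + 1 + 1)), D w = (x, y) := by
    refine exists_eq_of_coord_exact coord ?_ ?_ D ?_
      ((tensorGr L G i).prod (tensorGr L' G (i + 1))) _ ?_ ?_ ⟨hx, hy⟩
      (by rw [hD, hdx, hdy, sub_self, neg_zero]; rfl)
    · rintro ⟨x, y⟩
      refine ((E.finite_tensorCoord x).union (E.finite_tensorCoord y)).subset fun e he => ?_
      by_contra hne
      simp only [Set.mem_union, Set.mem_ofPred_eq, not_or, not_not] at hne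
      exact he (by rw [hcoord, hne.1, hne.2]; rfl)
    · rintro ⟨x, y⟩ h
      have h' := fun e => Prod.mk.inj ((hcoord e x y).symm.trans (h e))
      rw [E.eq_zero_of_tensorCoord fun e => (h' e).1, E.eq_zero_of_tensorCoord fun e => (h' e).2]
      rfl
    · rintro ⟨x, y⟩
      rw [hD, hD, map_neg, tensorD_tensorD, map_sub, tensorD_tensorD, map_neg, f.tensor_d]
      simp
    · rintro ⟨x, y⟩ h
      obtain ⟨hx, hy⟩ := AddSubgroup.mem_prod.1 h
      exact AddSubgroup.mem_prod.2
        ⟨neg_mem (tensorD_mem rfl hx), sub_mem (tensorD_mem rfl hy) (f.tensor_mem hx)⟩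
    · rintro e ⟨x, y⟩ hxy hd he
      obtain ⟨hx, hy⟩ := AddSubgroup.mem_prod.1 hxy
      rw [hD] at hd
      obtain ⟨hdx, hdy⟩ := Prod.mk.inj hd
      rw [neg_eq_zero] at hdx
      rw [sub_eq_zero] at hdy
      have he' := fun e' h => Prod.mk.inj ((hcoord e' x y).symm.trans (he e' h))
      obtain ⟨l, hl, l', hl', hdl, hdl'⟩ := hf.exists_cone (E.tensorCoord_mem hx e)
        (y := E.tensorCoord L' y e)
        (by simpa [show i + 1 - E.deg e = i - E.deg e + 1 by ring] using E.tensorCoord_mem hy e)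
        (by rw [← E.tensorCoord_d_of_le (fun e' h => (he' e' h).1) le_rfl, hdx, map_zero,
          Finsupp.zero_apply])
        (by rw [← E.tensorCoord_d_of_le (fun e' h => (he' e' h).2) le_rfl, hdy, tensorCoord_map])
      have hs : ∀ {L : DGModule.{u, v} B} (l : L), ∀ e' > e,
          E.tensorCoord L (tmk L G l (E.basis e)) e' = 0 := fun l e' he' => by
        rw [tensorCoord_tmk_basis, Finsupp.single_eq_of_ne he'.ne']
      refine ⟨(-tmk L G l (E.basis e), tmk L' G l' (E.basis e)), AddSubgroup.mem_prod.2
        ⟨neg_mem (tmk_mem (by ring) hl (E.mem e)), tmk_mem (by ring) hl' (E.mem e)⟩, ?_, ?_⟩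
      · rw [hD', hcoord, hcoord, map_add, Finsupp.add_apply,
          E.tensorCoord_d_of_le (hs l) le_rfl, E.tensorCoord_d_of_le (hs l') le_rfl,
          tensorCoord_map]
        simp only [tensorCoord_tmk_basis, Finsupp.single_eq_same, hdl, hdl', sub_add_cancel]
      · intro e' h
        rw [hD', hcoord, map_add, Finsupp.add_apply, E.tensorCoord_d_of_le (hs l) h.le,
          E.tensorCoord_d_of_le (hs l') h.le, tensorCoord_map, hs l e' h, hs l' e' h]
        simp
  obtain ⟨⟨x', y'⟩, ⟨hx', hy'⟩, h⟩ := key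
  rw [hD, Prod.mk.injEq] at h
  refine ⟨-x', neg_mem hx', y', hy', by rw [map_neg, h.1], ?_⟩
  rw [← h.2, map_neg]
  abel

/-- Tensoring with a semifree DG module preserves quasi-isomorphisms; here only the vanishing of
homology is recorded. -/
theorem subsingleton_tensorHomology_iff_of_isQuasiIso (E : OrderedBasis G ι)
    {L' : DGModule.{u, v} B} {f : Hom L L'}
    (hf : f.IsQuasiIso) (i : ℤ) :
    Subsingleton (tensorHomology L G i) ↔ Subsingleton (tensorHomology L' G i) := by
  rw [subsingleton_tensorHomology_iff, subsingleton_tensorHomology_iff]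
  constructor
  · intro h y hy hdy
    -- Exactness of the cone at `(0, y)` shows that the cycle `y` is, up to a boundary, the image of
    -- a cycle `x'` of `L ⊗[B] G`.
    obtain ⟨j, rfl⟩ : ∃ j, j + 1 = i := ⟨i - 1, by ring⟩
    obtain ⟨x', hx', y', hy', hdx', hdy'⟩ := E.exists_tensor_cone hf (zero_mem (tensorGr L G j)) hy
      (map_zero _) (by rw [hdy, map_zero])
    obtain ⟨w, hw, rfl⟩ := h x' hx' hdx'
    refine ⟨y' + f.tensor G w, add_mem hy' (f.tensor_mem hw), ?_⟩
    rw [map_add, hdy', ← f.tensor_d, sub_add_cancel]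
  · intro h x hx hdx
    obtain ⟨y, hy, hdy⟩ := h (f.tensor G x) (f.tensor_mem hx) (by rw [← f.tensor_d, hdx, map_zero])
    obtain ⟨x', hx', -, -, hdx', -⟩ := E.exists_tensor_cone hf hx hy hdx hdy
    exact ⟨x', hx', hdx'⟩

end OrderedBasis

end DGModule

/-! ### Free DG modules on prescribed boundaries and cellular resolutions -/

theorem Finset.sum_equivFin_symm {α X : Type*} [AddCommMonoid X] (s : Finset α) (f : α → X) :
    ∑ j, f (s.equivFin.symm j) = ∑ c ∈ s, f c := by
  rw [← Finset.sum_coe_sort s]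
  exact Fintype.sum_equiv s.equivFin.symm _ _ fun _ => rfl

namespace DGModule

variable {B : DGAlgebra.{u}}

section FreeGraded

variable {ι : Type t} (deg : ι → ℤ)

/-- The grading of the free module on generators `e` of degree `deg e`. -/
def finsuppGr (i : ℤ) : AddSubgroup (ι →₀ B) where
  carrier := {s | ∀ e, s e ∈ B.gr (i - deg e)}
  zero_mem' _ := zero_mem _
  add_mem' hs ht e := add_mem (hs e) (ht e)
  neg_mem' hs e := neg_mem (hs e)

theorem single_mem_finsuppGr {i j : ℤ} {e : ι} (h : i + deg e = j) {b : B} (hb : b ∈ B.gr i) :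
    Finsupp.single e b ∈ finsuppGr deg j := by
  intro e'
  by_cases he : e = e'
  · subst he
    rw [Finsupp.single_eq_same, ← h, add_sub_cancel_right]
    exact hb
  · rw [Finsupp.single_eq_of_ne (Ne.symm he)]
    exact zero_mem _

/-- The projection of a graded free module onto its component of degree `i`. -/
noncomputable def finsuppProj (i : ℤ) : (ι →₀ B) →+ ι →₀ B :=
  Finsupp.liftAddHom fun e =>
    (Finsupp.singleAddHom e).comp (homogeneousProj B.gr (i - deg e))

theorem finsuppProj_apply (i : ℤ) (s : ι →₀ B) (e : ι) :
    finsuppProj deg i s e = homogeneousProj B.gr (i - deg e) (s e) := by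
  induction s using Finsupp.induction_linear with
  | zero => simp
  | add s t hs ht => simp only [map_add, Finsupp.add_apply, hs, ht]
  | single e' b =>
    by_cases he : e' = e
    · subst he
      simp [finsuppProj]
    · simp [finsuppProj, he]

noncomputable instance : DirectSum.Decomposition (finsuppGr (B := B) deg) :=
  decompositionOfProj _ (finsuppProj deg)
    (fun i s hs => by
      ext e
      rw [finsuppProj_apply, homogeneousProj_of_mem _ (hs e)])
    (fun i j hij s hs => by
      ext e
      rw [finsuppProj_apply, homogeneousProj_of_ne _ (by lia) (hs e), Finsupp.zero_apply])
    (fun s => by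
      induction s using Finsupp.induction_linear with
      | zero => exact zero_mem _
      | add s t hs ht => exact add_mem hs ht
      | single e b =>
        induction b using homogeneous_induction B.gr with
        | h i b hb => exact AddSubgroup.mem_iSup_of_mem _ (single_mem_finsuppGr deg rfl hb)
        | hadd x y hx hy => rw [Finsupp.single_add]; exact add_mem hx hy)

/-- The derivation of a free module that takes the value `δ e` on the generator `e`. -/
noncomputable def finsuppD (δ : ι → ι →₀ B) : (ι →₀ B) →+ ι →₀ B :=
  Finsupp.liftAddHom fun e => (Finsupp.singleAddHom e).comp B.d +
    (((smulAddHom B (ι →₀ B)).flip (δ e)).comp (B.sgn 1))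

theorem finsuppD_single (δ : ι → ι →₀ B) (e : ι) (b : B) :
    finsuppD δ (Finsupp.single e b) = Finsupp.single e (B.d b) + B.sgn 1 b • δ e := by
  simp [finsuppD]

theorem finsuppD_smul (δ : ι → ι →₀ B) (b : B) (s : ι →₀ B) :
    finsuppD δ (b • s) = B.d b • s + B.sgn 1 b • finsuppD δ s := by
  induction s using Finsupp.induction_linear with
  | zero => simp
  | add s t hs ht => simp only [map_add, smul_add, hs, ht]; abel
  | single e c =>
    rw [Finsupp.smul_single, finsuppD_single, finsuppD_single, smul_eq_mul, DGAlgebra.d_mul_eq,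
      DGAlgebra.sgn_mul, smul_add, Finsupp.smul_single, Finsupp.smul_single, smul_eq_mul,
      smul_eq_mul, Finsupp.single_add, smul_smul, add_assoc]

theorem smul_mem_finsuppGr {i j : ℤ} {b : B} {s : ι →₀ B} (hb : b ∈ B.gr i)
    (hs : s ∈ finsuppGr deg j) : b • s ∈ finsuppGr deg (i + j) := fun e => by
  rw [Finsupp.smul_apply, smul_eq_mul, add_sub_assoc]
  exact B.mul_mem_gr hb (hs e)

/-- The free graded module on generators `e` of degree `deg e`, with the differential given by
prescribed boundaries `δ e` of the generators. -/
noncomputable def ofGenerators (δ : ι → ι →₀ B) (hδ : ∀ e, δ e ∈ finsuppGr deg (deg e - 1))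
    (hδδ : ∀ e, finsuppD δ (δ e) = 0) : DGModule.{u, max u t} B where
  carrier := ι →₀ B
  gr := finsuppGr deg
  smul_mem := smul_mem_finsuppGr deg
  d := finsuppD δ
  d_mem {i s} hs := by
    rw [← Finsupp.sum_single s, Finsupp.sum, map_sum]
    refine sum_mem fun e _ => ?_
    rw [finsuppD_single]
    refine add_mem (single_mem_finsuppGr deg (by ring) (B.d_mem (hs e))) ?_
    have := smul_mem_finsuppGr deg (DGAlgebra.sgn_mem 1 (hs e)) (hδ e)
    rwa [show i - deg e + (deg e - 1) = i - 1 by ring] at this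
  d_d s := by
    induction s using Finsupp.induction_linear with
    | zero => simp
    | add s t hs ht => simp only [map_add, hs, ht, add_zero]
    | single e b =>
      rw [finsuppD_single, map_add, finsuppD_single, finsuppD_smul, B.d_d, hδδ, DGAlgebra.d_sgn]
      simp
  d_smul {i b} hb s := by
    rw [finsuppD_smul, DGAlgebra.sgn_of_mem 1 hb, intUnits_smul_smul, mul_one]

end FreeGraded

section Cells

/-- The generators of a semifree resolution of `N`: a cell is a formal linear combination of cells,
its boundary, together with an element of `N`, its image, and a natural number that encodes its
degree. -/
inductive Cell (B : DGAlgebra.{u}) (N : DGModule.{u, w} B) : Type (max u w)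
  | mk (k : ℕ) (b : Fin k → B) (c : Fin k → Cell B N) (y : N) (i : ℕ) : Cell B N

variable {N : DGModule.{u, w} B} (n : ℤ)

namespace Cell

/-- The degree of a cell. -/
def deg : Cell B N → ℤ
  | mk _ _ _ _ i => n + i

/-- The depth of a cell. -/
def depth : Cell B N → ℕ
  | mk _ _ c _ _ => (Finset.univ.sup fun j => depth (c j)) + 1

open Classical in
/-- The boundary and the image of a cell; both are replaced by zero if the data are not those of a
cycle and of a bounding element of its image. -/
noncomputable def val : Cell B N → (Cell B N →₀ B) × N
  | mk _ b c y i =>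
    -- The conditions say that the prospective boundary and image are homogeneous of the right
    -- degrees, that the boundary is a cycle, and that the image bounds what the boundary maps to.
    -- The differential is written out in terms of the constituents `c j`, since only their values
    -- are available to the recursion. Invalid data give a generator with zero boundary and zero
    -- image; it does no harm, being killed by a further cell.
    if (∀ j, b j ∈ B.gr (n + i - 1 - deg n (c j))) ∧ y ∈ N.gr (n + i) ∧
        ∑ j, (Finsupp.single (c j) (B.d (b j)) + B.sgn 1 (b j) • (val (c j)).1) = 0 ∧
        N.d y = ∑ j, b j • (val (c j)).2 then
      (∑ j, Finsupp.single (c j) (b j), y)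
    else 0

/-- The boundary of a cell. -/
noncomputable abbrev bdry (u : Cell B N) : Cell B N →₀ B := (val n u).1

/-- The image of a cell. -/
noncomputable abbrev image (u : Cell B N) : N := (val n u).2

theorem bdry_mem (u : Cell B N) : u.bdry n ∈ finsuppGr (deg n) (u.deg n - 1) := by
  obtain ⟨k, b, c, y, i⟩ := u
  rw [bdry, val]
  split_ifs with h
  · exact sum_mem fun j _ => single_mem_finsuppGr _ (by rw [deg]; ring) (h.1 j)
  · exact zero_mem _

theorem image_mem (u : Cell B N) : u.image n ∈ N.gr (u.deg n) := by
  obtain ⟨k, b, c, y, i⟩ := u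
  rw [image, val]
  split_ifs with h
  · exact h.2.1
  · exact zero_mem _

theorem d_bdry (u : Cell B N) : finsuppD (bdry n) (u.bdry n) = 0 := by
  obtain ⟨k, b, c, y, i⟩ := u
  rw [bdry, val]
  split_ifs with h
  · simp only [map_sum, finsuppD_single]
    exact h.2.2.1
  · exact map_zero _

theorem d_image (u : Cell B N) :
    N.d (u.image n) = Finsupp.linearCombination B (image n) (u.bdry n) := by
  obtain ⟨k, b, c, y, i⟩ := u
  rw [image, bdry, val]
  split_ifs with h
  · simp only [map_sum, Finsupp.linearCombination_single]
    exact h.2.2.2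
  · simp

theorem linearCombination_image_mem {i : ℤ} {s : Cell B N →₀ B} (hs : s ∈ finsuppGr (deg n) i) :
    Finsupp.linearCombination B (image n) s ∈ N.gr i := by
  rw [Finsupp.linearCombination_apply]
  exact sum_mem fun u _ => N.smul_mem' (by ring) (hs u) (image_mem n u)

/-- The boundary of a cell is supported on its constituents, which have strictly smaller depth. So
depth can serve as the first key of a semibasis order. -/
theorem bdry_apply_of_depth_le {u u' : Cell B N} (h : u.depth ≤ u'.depth) : u.bdry n u' = 0 := by
  obtain ⟨k, b, c, y, i⟩ := u
  rw [bdry, val]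
  split_ifs
  · rw [Finsupp.finsetSum_apply]
    refine Finset.sum_eq_zero fun j _ => Finsupp.single_eq_of_ne ?_
    rintro rfl
    rw [depth] at h
    have := Finset.le_sup (f := fun j => depth (c j)) (Finset.mem_univ j)
    omega
  · rfl

/-- A cycle whose image is a boundary is the boundary of a cell. -/
theorem exists_cell {i : ℤ} (hi : n ≤ i + 1) {z : Cell B N →₀ B} (hz : z ∈ finsuppGr (deg n) i)
    (hdz : finsuppD (bdry n) z = 0) {y : N} (hy : y ∈ N.gr (i + 1))
    (hyz : N.d y = Finsupp.linearCombination B (image n) z) :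
    ∃ u : Cell B N, u.deg n = i + 1 ∧ u.bdry n = z ∧ u.image n = y := by
  -- The cell is obtained by listing the support of `z` by `Fin`; its degree `i + 1` is encoded by
  -- the natural number `i + 1 - n`, which is legitimate because `n ≤ i + 1`.
  set e := z.support.equivFin with he
  have hdeg : n + ((i + 1 - n).toNat : ℤ) = i + 1 := by omega
  have h : ∑ j, Finsupp.single (e.symm j : Cell B N) (z (e.symm j)) = z := by
    rw [he, z.support.sum_equivFin_symm fun c => Finsupp.single c (z c)]
    exact Finsupp.sum_single z
  have hval : val n (mk _ (fun j => z (e.symm j)) (fun j => e.symm j) y (i + 1 - n).toNat) =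
      (z, y) := by
    rw [val, hdeg, if_pos, h]
    refine ⟨fun j => by simpa using hz (e.symm j), hy, ?_, ?_⟩
    · rw [z.support.sum_equivFin_symm fun c => Finsupp.single c (B.d (z c)) + B.sgn 1 (z c) • (val n c).1, ← hdz,
        ← Finsupp.sum_single z, Finsupp.sum, map_sum]
      simp only [finsuppD_single, ← Finsupp.sum.eq_1, Finsupp.sum_single]
    · rw [z.support.sum_equivFin_symm fun c => z c • (val n c).2, hyz, Finsupp.linearCombination_apply, Finsupp.sum]
  exact ⟨mk _ _ _ _ _, hdeg, by rw [bdry, hval], by rw [image, hval]⟩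

end Cell

variable (N) in
/-- A semifree resolution of `N` by cells of degree at least `n`. -/
noncomputable def cellular : DGModule.{u, max u w} B :=
  ofGenerators (Cell.deg (N := N) n) (Cell.bdry n) (Cell.bdry_mem n) (Cell.d_bdry n)

/-- The augmentation of the cellular resolution. -/
noncomputable def cellularHom : Hom (cellular N n) N where
  toLinearMap := Finsupp.linearCombination B (Cell.image n)
  map_gr hs := Cell.linearCombination_image_mem n hs
  map_d s := by
    change Finsupp.linearCombination B (Cell.image n) (finsuppD (Cell.bdry n) s) =
      N.d (Finsupp.linearCombination B (Cell.image n) s)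
    induction s using Finsupp.induction_linear with
    | zero => simp
    | add s t hs ht => simp only [map_add, hs, ht]
    | single u b =>
      rw [finsuppD_single, map_add, map_smul, Finsupp.linearCombination_single,
        Finsupp.linearCombination_single, N.d_smul_eq, Cell.d_image]

theorem cellular_gr_eq_bot (hB : ∀ i < 0, B.gr i = ⊥) {i : ℤ} (hi : i < n) :
    (cellular N n).gr i = ⊥ := by
  rw [eq_bot_iff]
  intro s hs
  refine Finsupp.ext fun u => ?_
  have h := hs u
  obtain ⟨k, b, c, y, j⟩ := u
  rw [hB _ (by rw [Cell.deg]; lia)] at h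
  exact h

/-- The cells are closed under the formation of cells, so no limit over stages is needed. In degrees
at least `n`, a cycle whose image bounds is itself the boundary of a cell, and a cycle of `N` is the
image of a cell with zero boundary. Below `n` the source is zero and the target is acyclic. -/
theorem isQuasiIso_cellularHom (hB : ∀ i < 0, B.gr i = ⊥)
    (hN : ∀ i < n, Subsingleton (N.homology i)) : (cellularHom (N := N) n).IsQuasiIso := by
  intro i
  constructor
  · rw [Hom.homologyMap_injective_iff]
    intro z hz hdz y hy hyz
    rcases lt_or_ge i n with hi | hi
    · rw [cellular_gr_eq_bot n hB hi] at hz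
      exact ⟨0, zero_mem _, by rw [map_zero, AddSubgroup.mem_bot.1 hz]⟩
    · obtain ⟨u, hu, hu', -⟩ := Cell.exists_cell n (by lia) hz hdz hy hyz
      refine ⟨Finsupp.single u (1 : B), single_mem_finsuppGr _ (by lia) B.one_mem_gr, ?_⟩
      change finsuppD (Cell.bdry n) _ = z
      rw [finsuppD_single, hu', B.d_one, DGAlgebra.sgn_one, Finsupp.single_zero, zero_add]
      exact one_smul B (z : Cell B N →₀ B)
  · rw [Hom.homologyMap_surjective_iff]
    intro y hy hdy
    rcases lt_or_ge i n with hi | hi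
    · obtain ⟨w, hw, hwy⟩ := N.subsingleton_homology_iff.1 (hN i hi) y hy hdy
      exact ⟨0, zero_mem _, map_zero _, w, hw, by rw [hwy, map_zero, sub_zero]⟩
    · obtain ⟨u, hu, hu', hy'⟩ := Cell.exists_cell n (i := i - 1) (z := 0) (y := y) (by lia)
        (zero_mem _) (map_zero _) (by simpa using hy) (by rw [hdy, map_zero])
      refine ⟨Finsupp.single u (1 : B), single_mem_finsuppGr _ (by lia) B.one_mem_gr, ?_, 0,
        zero_mem _, ?_⟩
      · change finsuppD (Cell.bdry n) _ = 0
        rw [finsuppD_single, hu', B.d_one]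
        simp
      · change _ = y - Finsupp.linearCombination B (Cell.image n) _
        rw [Finsupp.linearCombination_single, one_smul, hy', map_zero, sub_self]

/-- Cells are ordered by depth, with ties broken by an arbitrary well-order; boundaries strictly
lower the depth. -/
theorem isSemifree_cellular [Nontrivial B] : (cellular N n).IsSemifree := by
  classical
  let g : Cell B N → ℕ × Cell B N := fun u => (u.depth, u)
  let r : Cell B N → Cell B N → Prop := g ⁻¹'o Prod.Lex (· < ·) WellOrderingRel
  have hg : Function.Injective g := fun x y h => (Prod.mk.inj h).2
  have hr : IsWellOrder (Cell B N) r :=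
    RelEmbedding.isWellOrder (⟨⟨g, hg⟩, Iff.rfl⟩ : r ↪r Prod.Lex (· < ·) WellOrderingRel)
  let o : LinearOrder (Cell B N) := linearOrderOfSTO r
  have hwf : WellFoundedLT (Cell B N) := ⟨hr.wf⟩
  refine OrderedBasis.isSemifree (ι := Cell B N)
    { basis := ⟨LinearEquiv.refl B (Cell B N →₀ B)⟩
      deg := Cell.deg n
      mem := fun u => single_mem_finsuppGr _ (zero_add _) B.one_mem_gr
      repr_d := fun u u' huu' => ?_ }
  change finsuppD (Cell.bdry n) (Finsupp.single u 1) u' = 0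
  rw [finsuppD_single, B.d_one, DGAlgebra.sgn_one, one_smul, Finsupp.single_zero, zero_add]
  refine Cell.bdry_apply_of_depth_le n ?_
  by_contra hlt
  exact not_lt.2 huu' (Prod.Lex.left _ _ (not_le.1 hlt) : r u' u)

/-- The chosen resolution is defined by `Classical.epsilon` and carries no information until some
resolution is known to exist; the cellular one is the witness. -/
theorem isSemifreeResolutionOf_semifreeResolution [Nontrivial B] (hB : ∀ i < 0, B.gr i = ⊥)
    (hN : ∀ i < n, Subsingleton (N.homology i)) :
    IsSemifreeResolutionOf (semifreeResolution N) N :=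
  Classical.epsilon_spec (p := fun G => IsSemifreeResolutionOf G N)
    ⟨cellular N n, isSemifree_cellular n, cellularHom n, isQuasiIso_cellularHom n hB hN⟩

end Cells

end DGModule

/-! ### Homological finiteness of perfect DG modules -/

namespace DGAlgebra.IsLocal

variable {B : DGAlgebra.{u}}

theorem d_eq_zero (hB : B.IsLocal) {b : B} (hb : b ∈ B.gr 0) : B.d b = 0 := by
  have := B.d_mem hb
  rwa [hB.gr_neg _ (by norm_num)] at this

theorem nontrivial (hB : B.IsLocal) : Nontrivial B := by
  have := hB.isLocalRing
  exact (B.gr 0).subtype_injective.nontrivial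

/-- Every element of degree zero of a local DG algebra is a cycle. -/
def grZeroEquiv (hB : B.IsLocal) : B.gr 0 ≃+* B.cyclesZero where
  toFun b := ⟨b, b.2, hB.d_eq_zero b.2⟩
  invFun z := ⟨z, z.2.1⟩
  left_inv _ := rfl
  right_inv _ := rfl
  map_mul' _ _ := rfl
  map_add' _ _ := rfl

theorem isNoetherianRing_cyclesZero (hB : B.IsLocal) : IsNoetherianRing B.cyclesZero := by
  have := hB.isNoetherianRing
  exact isNoetherianRing_of_ringEquiv _ hB.grZeroEquiv

theorem isLocalRing_cyclesZero (hB : B.IsLocal) : IsLocalRing B.cyclesZero := by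
  have := hB.isLocalRing
  exact hB.grZeroEquiv.isLocalRing

end DGAlgebra.IsLocal

namespace DGModule

variable {B : DGAlgebra.{u}}

/-- The cycles of degree zero act through their quotient `H₀(B)`. Over `B.cyclesZero`, which is
noetherian when `B` is local, the maps induced in homology are linear by construction, so finiteness
is handled there. -/
theorem finite_homology_iff (M : DGModule.{u, v} B) (i : ℤ) :
    Module.Finite B.HZero (M.homology i) ↔ Module.Finite B.cyclesZero (M.homology i) := by
  have : IsScalarTower B.cyclesZero B.HZero (M.homology i) :=
    (M.isTorsionBySet_homology i).isScalarTower
  exact ⟨fun _ => Module.Finite.trans B.HZero _, fun _ => Module.Finite.of_restrictScalars_finite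
    B.cyclesZero _ _⟩

namespace Hom

variable {M : DGModule.{u, v} B} {N : DGModule.{u, w} B} {f : Hom M N}

theorem IsQuasiIso.subsingleton_homology_iff (hf : f.IsQuasiIso) (i : ℤ) :
    Subsingleton (M.homology i) ↔ Subsingleton (N.homology i) :=
  (Equiv.ofBijective _ (hf i)).subsingleton_congr

theorem IsQuasiIso.homologyBoundedBelow_iff (hf : f.IsQuasiIso) :
    M.HomologyBoundedBelow ↔ N.HomologyBoundedBelow := by
  simp only [HomologyBoundedBelow, hf.subsingleton_homology_iff]

theorem IsQuasiIso.homologyDegreewiseFinite_iff (hf : f.IsQuasiIso) :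
    M.HomologyDegreewiseFinite ↔ N.HomologyDegreewiseFinite := by
  refine forall_congr' fun i => ?_
  rw [finite_homology_iff, finite_homology_iff]
  exact Module.Finite.equiv_iff (LinearEquiv.ofBijective _ (hf i))

end Hom

namespace IsDirectSummand

variable {P F : DGModule.{u, v} B}

theorem homologyBoundedBelow (h : P.IsDirectSummand F) (hF : F.HomologyBoundedBelow) :
    P.HomologyBoundedBelow := by
  obtain ⟨s, p, hsp⟩ := h
  obtain ⟨n, hn⟩ := hF
  refine ⟨n, fun i hi => P.subsingleton_homology_iff.2 fun z hz hdz => ?_⟩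
  obtain ⟨w, hw, hwz⟩ := F.subsingleton_homology_iff.1 (hn i hi) _ (s.map_gr hz)
    (by rw [← s.map_d, hdz, map_zero])
  exact ⟨p.toLinearMap w, p.map_gr hw, by rw [← p.map_d, hwz, hsp]⟩

theorem homologyDegreewiseFinite (h : P.IsDirectSummand F) (hF : F.HomologyDegreewiseFinite) :
    P.HomologyDegreewiseFinite := by
  obtain ⟨s, p, hsp⟩ := h
  intro i
  have := (finite_homology_iff _ _).1 (hF i)
  rw [finite_homology_iff]
  refine Module.Finite.of_surjective (p.homologyMap i) (p.homologyMap_surjective_iff.2 ?_)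
  intro y hy hdy
  exact ⟨s.toLinearMap y, s.map_gr hy, by rw [← s.map_d, hdy, map_zero], 0, zero_mem _,
    by rw [hsp, sub_self, map_zero]⟩

theorem torBounded {N : DGModule.{u, w} B} (h : P.IsDirectSummand F) (hF : TorBounded F N) :
    TorBounded P N := by
  obtain ⟨s, p, hsp⟩ := h
  obtain ⟨n, hn⟩ := hF
  refine ⟨n, fun i hi => subsingleton_tensorHomology_iff.2 fun z hz hdz => ?_⟩
  obtain ⟨w, hw, hwz⟩ := subsingleton_tensorHomology_iff.1 (hn i hi) _ (s.tensor_mem hz)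
    (by rw [← s.tensor_d, hdz, map_zero])
  refine ⟨p.tensor _ w, p.tensor_mem hw, ?_⟩
  rw [← p.tensor_d, hwz]
  clear hwz hz hdz hw
  induction z using tensor_induction with
  | h i x hx y => rw [Hom.tensor_tmk, Hom.tensor_tmk, hsp]
  | hadd y z hy hz => rw [map_add, map_add, hy, hz]

end IsDirectSummand

namespace OrderedBasis

section

variable {G : DGModule.{u, v} B} {ι : Type w} [LinearOrder ι] (E : OrderedBasis G ι)

/-- The differential acts on the leading coordinate through the differential of `B`. -/
theorem repr_d_of_le {e : ι} {g : G} (hg : ∀ e' > e, E.basis.repr g e' = 0) {e' : ι}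
    (he' : e ≤ e') : E.basis.repr (G.d g) e' = B.d (E.basis.repr g e') := by
  obtain ⟨s, rfl⟩ := E.basis.repr.symm.surjective g
  rw [LinearEquiv.apply_symm_apply] at hg ⊢
  have hs : ∀ e'' ∈ s.support, e'' ≤ e' := fun e'' h => by
    by_contra hlt
    exact Finsupp.mem_support_iff.1 h (hg e'' (lt_of_le_of_lt he' (not_le.1 hlt)))
  clear hg
  induction s using Finsupp.induction with
  | zero => simp
  | single_add a b s has hb ih =>
    rw [Finsupp.support_single_add has hb] at hs
    simp only [map_add, Finsupp.add_apply, ih fun e'' h => hs e'' (Finset.mem_cons.2 (Or.inr h))]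
    congr 1
    have ha : a ≤ e' := hs a (Finset.mem_cons_self _ _)
    rw [Module.Basis.repr_symm_single, G.d_smul_eq, map_add, map_smul, map_smul, Finsupp.add_apply,
      Finsupp.smul_apply, Finsupp.smul_apply, E.repr_d a e' ha, smul_zero, add_zero,
      Module.Basis.repr_self]
    by_cases hae : a = e'
    · subst hae
      simp
    · simp [hae]

/-- Change of the index type along an order isomorphism. -/
noncomputable def reindex {κ : Type t} [LinearOrder κ] (φ : ι ≃o κ) : OrderedBasis G κ where
  basis := E.basis.reindex φ.toEquiv
  deg k := E.deg (φ.symm k)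
  mem k := by simpa using E.mem (φ.symm k)
  repr_d k k' h := by
    rw [Module.Basis.repr_reindex_apply, Module.Basis.reindex_apply]
    exact E.repr_d _ _ (φ.symm.monotone h)

theorem gr_eq_bot (hB : ∀ i < 0, B.gr i = ⊥) {i : ℤ} (hi : ∀ e, i < E.deg e) : G.gr i = ⊥ := by
  rw [eq_bot_iff]
  intro g hg
  refine E.basis.repr.injective (Finsupp.ext fun e => ?_)
  have := E.repr_mem hg e
  rw [hB _ (by linarith [hi e])] at this
  rw [map_zero]
  exact this

theorem homologyBoundedBelow [Finite ι] (E : OrderedBasis G ι) (hB : ∀ i < 0, B.gr i = ⊥) : G.HomologyBoundedBelow := by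
  obtain ⟨n, hn⟩ := (Set.finite_range E.deg).bddBelow
  refine ⟨n, fun i hi => G.subsingleton_homology_iff.2 fun z hz _ => ⟨0, zero_mem _, ?_⟩⟩
  rw [E.gr_eq_bot hB fun e => lt_of_lt_of_le hi (hn ⟨e, rfl⟩)] at hz
  rw [map_zero, AddSubgroup.mem_bot.1 hz]

end

section Finite

variable {G : DGModule.{u, v} B} {n : ℕ} (E : OrderedBasis G (Fin n))

/-- The cycles of degree `i` in the span of the first `k` elements of a semibasis. -/
def cyclesSpan (i : ℤ) (k : ℕ) : Submodule B.cyclesZero (G.cycles i) where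
  carrier := {z | ∀ e : Fin n, k ≤ e → E.basis.repr (z : G) e = 0}
  zero_mem' e _ := by simp
  add_mem' hx hy e he := by simp [hx e he, hy e he]
  smul_mem' c x hx e he := by
    change E.basis.repr ((c : B) • (x : G)) e = 0
    rw [map_smul, Finsupp.smul_apply, hx e he, smul_zero]

/-- The leading coefficient of the cycles in the span of the elements up to `e`. -/
noncomputable def leadingCoeff (i : ℤ) (e : Fin n) :
    E.cyclesSpan i (e + 1) →ₗ[B.cyclesZero] B.self.cycles (i - E.deg e) where
  toFun z := ⟨E.basis.repr ((z : G.cycles i) : G) e, E.repr_mem z.1.2.1 e, by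
    change B.d _ = 0
    rw [← E.repr_d_of_le (fun e' he' => z.2 e' he') le_rfl, z.1.2.2, map_zero, Finsupp.zero_apply]⟩
  map_add' x y := Subtype.ext (by simp; rfl)
  map_smul' c x := Subtype.ext (by
    change E.basis.repr ((c : B) • ((x : G.cycles i) : G)) e = (c : B) * _
    rw [map_smul, Finsupp.smul_apply, smul_eq_mul])

/-- Induction on `k`. The class in `H(B)` of the leading coefficient is a linear map `φ` on the
cycles in the span of the first `k + 1` generators. Its range is finitely generated because `H(B)`
is degreewise finite over a noetherian ring, and cycles in its kernel are homologous to cycles in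
the span of the first `k` generators. Lifts of generators of the range, together with the previous
stage, therefore generate. -/
theorem fg_map_cyclesSpan [IsNoetherianRing B.cyclesZero] (hB : B.self.HomologyDegreewiseFinite)
    (i : ℤ) (k : ℕ) (hk : k ≤ n) : ((E.cyclesSpan i k).map (G.homologyMk i)).FG := by
  induction k with
  | zero =>
    have : E.cyclesSpan i 0 = ⊥ := by
      rw [eq_bot_iff]
      intro z hz
      exact Subtype.ext (E.basis.repr.injective (Finsupp.ext fun e => by
        rw [hz e (Nat.zero_le _)]; simp))
    rw [this, Submodule.map_bot]
    exact Submodule.fg_bot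
  | succ k ih =>
    let e : Fin n := ⟨k, hk⟩
    have := (finite_homology_iff _ _).1 (hB (i - E.deg e))
    let φ := (B.self.homologyMk (i - E.deg e)).comp (E.leadingCoeff i e)
    obtain ⟨m, s, hs⟩ := Module.Finite.exists_fin (R := B.cyclesZero) (M := LinearMap.range φ)
    choose t ht using fun j => (s j).2
    refine Submodule.FG.of_le (T := Submodule.span B.cyclesZero
      (Set.range fun j => G.homologyMk i (t j)) ⊔ (E.cyclesSpan i k).map (G.homologyMk i))
      ((Submodule.fg_span (Set.finite_range _)).sup (ih (by omega))) ?_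
    rintro _ ⟨z, hz, rfl⟩
    let z₀ : E.cyclesSpan i (e + 1) := ⟨z, hz⟩
    have hmem : (⟨φ z₀, ⟨_, rfl⟩⟩ : LinearMap.range φ) ∈
        Submodule.span B.cyclesZero (Set.range s) := hs ▸ Submodule.mem_top
    obtain ⟨c, hc⟩ := Submodule.mem_span_range_iff_exists_fun _ |>.1 hmem
    have hc' : ∑ j, c j • φ (t j) = φ z₀ := by
      have := congrArg Subtype.val hc
      simpa [ht] using this
    obtain ⟨y, hy⟩ : ∃ y, y = z₀ + ∑ j, (-c j) • t j := ⟨_, rfl⟩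
    have h0 : φ y = 0 := by
      rw [hy, map_add, map_sum, ← hc']
      simp
    obtain ⟨b, hb, hdb⟩ : ∃ b ∈ B.gr (i - E.deg e + 1), B.d b = E.basis.repr (y.1 : G) e :=
      B.self.homologyMk_eq_zero.1 h0
    have hbm : b • E.basis e ∈ G.gr (i + 1) := G.smul_mem' (by ring) hb (E.mem e)
    -- The leading coefficient of `y` is `d b`, so subtracting `d (b • e)` removes it without
    -- changing the homology class.
    let z' : G.cycles i := y.1 - ⟨G.d (b • E.basis e), by simpa using G.d_mem hbm, G.d_d _⟩
    have hz' : z' ∈ E.cyclesSpan i k := by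
      intro e' he'
      change E.basis.repr ((y.1 : G) - G.d (b • E.basis e)) e' = 0
      have hle : e ≤ e' := he'
      rw [map_sub, Finsupp.sub_apply, E.repr_d_of_le (e := e) (fun e'' he'' => ?_) hle]
      · rcases hle.eq_or_lt with rfl | hlt
        · rw [map_smul, Finsupp.smul_apply, Module.Basis.repr_self, Finsupp.single_eq_same,
            smul_eq_mul, mul_one, sub_eq_zero]
          exact hdb.symm
        · rw [y.2 e' hlt, map_smul, Finsupp.smul_apply, Module.Basis.repr_self,
            Finsupp.single_eq_of_ne hlt.ne', smul_zero, map_zero, sub_zero]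
      · rw [map_smul, Finsupp.smul_apply, Module.Basis.repr_self,
          Finsupp.single_eq_of_ne he''.ne', smul_zero]
    have hzz' : G.homologyMk i z = ∑ j, c j • G.homologyMk i (t j) + G.homologyMk i z' := by
      have : G.homologyMk i z' = G.homologyMk i y.1 := by
        rw [map_sub, sub_eq_self]
        exact G.homologyMk_eq_zero.2 ⟨_, hbm, rfl⟩
      rw [this, hy]
      simp [z₀]
    rw [hzz']
    refine Submodule.add_mem_sup (Submodule.sum_mem _ fun j _ => Submodule.smul_mem _ _
      (Submodule.subset_span ⟨j, rfl⟩)) ⟨z', hz', rfl⟩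

theorem homologyDegreewiseFinite [IsNoetherianRing B.cyclesZero] (E : OrderedBasis G (Fin n))
    (hB : B.self.HomologyDegreewiseFinite) : G.HomologyDegreewiseFinite := by
  intro i
  rw [finite_homology_iff]
  refine ⟨?_⟩
  have : E.cyclesSpan i n = ⊤ := eq_top_iff.2 fun z _ e he => absurd e.2 (not_lt.2 he)
  have h := E.fg_map_cyclesSpan hB i n le_rfl
  rwa [this, Submodule.map_top, LinearMap.range_eq_top.2 (G.homologyMk_surjective i)] at h

end Finite

end OrderedBasis

theorem IsFiniteSemifree.exists_orderedBasis {F : DGModule.{u, v} B} (hF : F.IsFiniteSemifree) :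
    ∃ n, Nonempty (OrderedBasis F (Fin n)) := by
  obtain ⟨S, r, hS, h⟩ := hF
  obtain ⟨o, -, ⟨E⟩⟩ := h.exists_orderedBasis
  have := hS.fintype
  exact ⟨_, ⟨E.reindex (Fintype.orderIsoFinOfCardEq S rfl).symm⟩⟩

section Residue

variable (hB : B.IsLocal)

theorem subsingleton_homology_residueDGModule {i : ℤ} (hi : i ≠ 0) :
    Subsingleton (hB.residueDGModule.homology i) :=
  (subsingleton_homology_iff _).2 fun z hz _ =>
    ⟨0, zero_mem _, by rw [map_zero]; exact (eq_zero_of_mem_grConcentrated hi hz).symm⟩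

theorem isSemifreeResolutionOf_residue :
    IsSemifreeResolutionOf (semifreeResolution hB.residueDGModule) hB.residueDGModule :=
  have := hB.nontrivial
  isSemifreeResolutionOf_semifreeResolution 0 hB.gr_neg fun _ hi =>
    subsingleton_homology_residueDGModule hB hi.ne

theorem subsingleton_tor_iff {L L' : DGModule.{u, v} B} {f : Hom L L'} (hf : f.IsQuasiIso)
    (i : ℤ) : Subsingleton (Tor L hB.residueDGModule i) ↔
      Subsingleton (Tor L' hB.residueDGModule i) := by
  obtain ⟨S, r, h⟩ := (isSemifreeResolutionOf_residue hB).1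
  obtain ⟨_, _, ⟨E⟩⟩ := h.exists_orderedBasis
  exact E.subsingleton_tensorHomology_iff_of_isQuasiIso hf i

/-- After the swap, dévissage along the semibasis of `F` reduces to the homology of the resolution
of `k` in degrees `i - deg e`. That is nonzero only if `i = deg e`, so the largest `|deg e|` is a
bound. -/
theorem IsFiniteSemifree.torBounded {F : DGModule.{u, v} B} (hF : F.IsFiniteSemifree) :
    TorBounded F hB.residueDGModule := by
  obtain ⟨n, ⟨E⟩⟩ := hF.exists_orderedBasis
  obtain ⟨-, f, hf⟩ := isSemifreeResolutionOf_residue hB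
  obtain ⟨m, hm⟩ := (Set.finite_range fun e => |E.deg e|).bddAbove
  refine ⟨m, fun i hi => subsingleton_tensorHomology_swap (E.subsingleton_tensorHomology
    fun e => ?_)⟩
  rw [hf.subsingleton_homology_iff]
  refine subsingleton_homology_residueDGModule hB fun h => ?_
  have := hm ⟨e, rfl⟩
  rw [sub_eq_zero] at h
  rw [h] at hi
  exact not_lt.2 this hi

/-- The homological finiteness conditions that characterize perfect DG modules. -/
def HomologicallyFinite (M : DGModule.{u, v} B) : Prop :=
  M.HomologyBoundedBelow ∧ M.HomologyDegreewiseFinite ∧ TorBounded M hB.residueDGModule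

theorem Hom.IsQuasiIso.homologicallyFinite_iff {L L' : DGModule.{u, v} B} {f : Hom L L'}
    (hf : f.IsQuasiIso) : L.HomologicallyFinite hB ↔ L'.HomologicallyFinite hB := by
  rw [HomologicallyFinite, hf.homologyBoundedBelow_iff, hf.homologyDegreewiseFinite_iff]
  simp only [TorBounded, subsingleton_tor_iff hB hf]
  rfl

theorem QuasiIsomorphic.homologicallyFinite_iff {L L' : DGModule.{u, v} B}
    (h : L.QuasiIsomorphic L') : L.HomologicallyFinite hB ↔ L'.HomologicallyFinite hB := by
  induction h with
  | rel _ _ h =>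
    obtain ⟨f, hf⟩ := h
    exact hf.homologicallyFinite_iff hB
  | refl => rfl
  | symm _ _ _ ih => exact ih.symm
  | trans _ _ _ _ _ ih ih' => exact ih.trans ih'

theorem IsFiniteSemifree.homologicallyFinite {F : DGModule.{u, v} B} (hF : F.IsFiniteSemifree) :
    F.HomologicallyFinite hB := by
  obtain ⟨n, ⟨E⟩⟩ := hF.exists_orderedBasis
  have := hB.isNoetherianRing_cyclesZero
  exact ⟨E.homologyBoundedBelow hB.gr_neg, E.homologyDegreewiseFinite hB.degreewiseFinite,
    hF.torBounded hB⟩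

theorem IsPerfect.homologicallyFinite {M : DGModule.{u, v} B} (hM : M.IsPerfect) :
    M.HomologicallyFinite hB := by
  obtain ⟨F, P, hF, hP, hMP⟩ := hM
  obtain ⟨h1, h2, h3⟩ := hF.homologicallyFinite hB
  exact (hMP.homologicallyFinite_iff hB).2
    ⟨hP.homologyBoundedBelow h1, hP.homologyDegreewiseFinite h2, hP.torBounded h3⟩

theorem IsFiniteSemifree.isPerfect {F M : DGModule.{u, v} B} (hF : F.IsFiniteSemifree)
    (h : M.QuasiIsomorphic F) : M.IsPerfect :=
  ⟨F, F, hF, ⟨Hom.id F, Hom.id F, fun _ => rfl⟩, h⟩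

end Residue

end DGModule

/-! ### Attaching a cell, and the homotopy fibre that undoes it -/

namespace DGModule

variable {B : DGAlgebra.{u}}

section Twist

/-- The product of two graded abelian groups. -/
noncomputable instance {X Y : Type*} [AddCommGroup X] [AddCommGroup Y] (gX : ℤ → AddSubgroup X)
    (gY : ℤ → AddSubgroup Y) [DirectSum.Decomposition gX] [DirectSum.Decomposition gY] :
    DirectSum.Decomposition fun i => (gX i).prod (gY i) :=
  decompositionOfProj _ (fun i => (homogeneousProj gX i).prodMap (homogeneousProj gY i))
    (fun i x hx => Prod.ext (homogeneousProj_of_mem _ hx.1) (homogeneousProj_of_mem _ hx.2))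
    (fun i j hij x hx =>
      Prod.ext (homogeneousProj_of_ne _ hij hx.1) (homogeneousProj_of_ne _ hij hx.2))
    (fun x => by
      have h1 : ∀ a : X, ((a, 0) : X × Y) ∈ ⨆ i, (gX i).prod (gY i) := fun a => by
        induction a using homogeneous_induction gX with
        | h i a ha =>
          exact AddSubgroup.mem_iSup_of_mem i (AddSubgroup.mem_prod.2 ⟨ha, zero_mem _⟩)
        | hadd a a' ha ha' => simpa using add_mem ha ha'
      have h2 : ∀ b : Y, ((0, b) : X × Y) ∈ ⨆ i, (gX i).prod (gY i) := fun b => by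
        induction b using homogeneous_induction gY with
        | h i b hb =>
          exact AddSubgroup.mem_iSup_of_mem i (AddSubgroup.mem_prod.2 ⟨zero_mem _, hb⟩)
        | hadd b b' hb hb' => simpa using add_mem hb hb'
      simpa using add_mem (h1 x.1) (h2 x.2))

/-- The extension of `C` by `A` whose differential is twisted by a map `τ : C → A` of
degree `-1`. -/
noncomputable abbrev twist (A : DGModule.{u, v} B) (C : DGModule.{u, w} B) (τ : C →+ A)
    (hmem : ∀ i, ∀ c ∈ C.gr i, τ c ∈ A.gr (i - 1)) (hd : ∀ c, τ (C.d c) = -A.d (τ c))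
    (hsmul : ∀ (b : B) (c : C), τ (b • c) = B.sgn 1 b • τ c) : DGModule.{u, max v w} B where
  carrier := A × C
  gr i := (A.gr i).prod (C.gr i)
  smul_mem hb hm := AddSubgroup.mem_prod.2 ⟨A.smul_mem hb hm.1, C.smul_mem hb hm.2⟩
  d := AddMonoidHom.prod (A.d.comp (AddMonoidHom.fst A C) + τ.comp (AddMonoidHom.snd A C))
    (C.d.comp (AddMonoidHom.snd A C))
  d_mem {i m} hm := AddSubgroup.mem_prod.2
    ⟨add_mem (A.d_mem hm.1) (hmem i _ hm.2), C.d_mem hm.2⟩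
  d_d m := by
    refine Prod.ext ?_ (C.d_d _)
    change A.d (A.d m.1 + τ m.2) + τ (C.d m.2) = 0
    rw [map_add, A.d_d, hd, zero_add, add_neg_cancel]
  d_smul {i b} hb m := by
    have hsgn : ∀ {X : Type _} [AddCommGroup X] [Module B X] (x : X),
        i.negOnePow • (b • x) = B.sgn 1 b • x := fun x => by
      rw [DGAlgebra.sgn_of_mem 1 hb, intUnits_smul_smul, mul_one]
    rw [hsgn]
    refine Prod.ext ?_ (C.d_smul_eq _ _)
    change A.d (b • m.1) + τ (b • m.2) = B.d b • m.1 + B.sgn 1 b • (A.d m.1 + τ m.2)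
    rw [A.d_smul_eq, hsmul, smul_add, add_assoc]

variable (B) in
/-- The free DG module on a cycle of degree `n`. -/
noncomputable abbrev free (n : ℤ) : DGModule.{u, u} B where
  carrier := B
  gr i := B.gr (i - n)
  decomposition := decompositionOfProj _ (fun i => homogeneousProj B.gr (i - n))
    (fun i x hx => homogeneousProj_of_mem _ hx)
    (fun i j hij x hx => homogeneousProj_of_ne _ (by lia) hx)
    (fun x => by
      induction x using homogeneous_induction B.gr with
      | h i x hx => exact AddSubgroup.mem_iSup_of_mem (i + n) (by simpa using hx)
      | hadd x y hx hy => exact add_mem hx hy)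
  smul_mem {i j b m} hb hm := by
    have := B.mul_mem_gr hb hm
    rwa [← add_sub_assoc] at this
  d := B.d
  d_mem {i m} hm := by
    have := B.d_mem hm
    rwa [sub_right_comm] at this
  d_d := B.d_d
  d_smul := B.d_mul

/-- The semibasis of a free DG module. -/
noncomputable def freeOrderedBasis (n : ℤ) : OrderedBasis (free B n) (Fin 1) where
  basis := Module.Basis.singleton (Fin 1) B
  deg _ := n
  mem e := by
    rw [Module.Basis.singleton_apply]
    change (1 : B) ∈ B.gr (n - n)
    rw [sub_self]
    exact B.one_mem_gr
  repr_d e e' _ := by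
    rw [Module.Basis.singleton_apply, show (free B n).d (1 : B) = 0 from B.d_one, map_zero]
    rfl

end Twist

section Attach

variable (M : DGModule.{u, v} B) {n : ℤ} (x : M.cycles n)

/-- The DG module obtained from `M` by attaching a cell with boundary `x`. -/
noncomputable abbrev attach : DGModule.{u, max v u} B :=
  twist M (free B (n + 1)) (((smulAddHom B M).flip (x : M)).comp (B.sgn 1))
    (fun i b hb => M.smul_mem' (i := i - (n + 1)) (by ring) (DGAlgebra.sgn_mem 1 hb) x.2.1)
    (fun b => by
      change B.sgn 1 (B.d b) • (x : M) = -M.d (B.sgn 1 b • (x : M))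
      rw [M.d_smul_eq, x.2.2, smul_zero, add_zero, DGAlgebra.d_sgn]
      simp)
    (fun b c => by
      change B.sgn 1 (b * c) • (x : M) = _
      rw [DGAlgebra.sgn_mul, mul_smul]
      rfl)

variable {M x}

theorem attach_d (m : M) (b : B) :
    (M.attach x).d (m, b) = (M.d m + B.sgn 1 b • (x : M), B.d b) := rfl

theorem mem_attach {i : ℤ} {m : M} {b : B} :
    ((m, b) : M × B) ∈ (M.attach x).gr i ↔ m ∈ M.gr i ∧ b ∈ B.gr (i - (n + 1)) := Iff.rfl

variable (M x)

/-- The inclusion of `M`. -/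
noncomputable def attachInl : Hom M (M.attach x) where
  toLinearMap := LinearMap.inl B M B
  map_gr hm := mem_attach.2 ⟨hm, zero_mem _⟩
  map_d m := by
    change ((M.d m, 0) : M × B) = (M.attach x).d (m, 0)
    rw [attach_d]
    simp

/-- The projection onto the free DG module on the attached cell. -/
noncomputable def attachSnd : Hom (M.attach x) (free B (n + 1)) where
  toLinearMap := LinearMap.snd B M B
  map_gr hm := hm.2
  map_d _ := rfl

variable {M x}

/-- The cell has degree `n + 1` and `B` is non-negative, so in degrees at most `n` the underlying
group is unchanged and there can only be new boundaries. -/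
theorem subsingleton_homology_attach (hB : ∀ i < 0, B.gr i = ⊥) {i : ℤ} (hi : i ≤ n)
    (h : Subsingleton (M.homology i)) : Subsingleton ((M.attach x).homology i) := by
  rw [subsingleton_homology_iff] at h ⊢
  rintro ⟨m, b⟩ hmb hd
  obtain ⟨hm, hb⟩ := mem_attach.1 hmb
  rw [hB _ (by lia), AddSubgroup.mem_bot] at hb
  subst hb
  rw [attach_d, map_zero, zero_smul, add_zero] at hd
  obtain ⟨w, hw, rfl⟩ := h m hm (Prod.mk.inj hd).1
  exact ⟨(w, 0), mem_attach.2 ⟨hw, zero_mem _⟩, by rw [attach_d]; simp⟩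

theorem surjective_homologyMap_attachInl (hB : ∀ i < 0, B.gr i = ⊥) :
    Function.Surjective ((M.attachInl x).homologyMap n) := by
  rw [Hom.homologyMap_surjective_iff]
  rintro ⟨m, b⟩ hmb hd
  obtain ⟨hm, hb⟩ := mem_attach.1 hmb
  rw [hB _ (by lia), AddSubgroup.mem_bot] at hb
  subst hb
  rw [attach_d, map_zero, zero_smul, add_zero] at hd
  exact ⟨m, hm, (Prod.mk.inj hd).1, 0, zero_mem _, (map_zero _).trans (sub_self _).symm⟩

theorem homologyMap_attachInl_mk :
    (M.attachInl x).homologyMap n (M.homologyMk n x) = 0 := by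
  rw [Hom.homologyMap_mk, homologyMk_eq_zero]
  refine ⟨((0, 1) : M × B), mem_attach.2 ⟨zero_mem _, by simpa using B.one_mem_gr⟩, ?_⟩
  rw [attach_d, map_zero, zero_add, DGAlgebra.sgn_one, one_smul, B.d_one]
  rfl

/-- Exactness in the middle of `H(M) → H(M.attach x) → H(B[n+1])` suffices over a noetherian ring,
since both ends are finite. -/
theorem homologyDegreewiseFinite_attach [IsNoetherianRing B.cyclesZero]
    (hB : B.self.HomologyDegreewiseFinite) (hM : M.HomologyDegreewiseFinite) :
    (M.attach x).HomologyDegreewiseFinite := by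
  intro i
  have h1 := (finite_homology_iff _ _).1 (hM i)
  have h2 := (finite_homology_iff _ _).1 ((freeOrderedBasis (n + 1)).homologyDegreewiseFinite hB i)
  rw [finite_homology_iff]
  have := isNoetherian_of_range_eq_ker ((M.attachInl x).homologyMap i)
    ((M.attachSnd x).homologyMap i) ?_
  · infer_instance
  refine le_antisymm ?_ fun y hy => ?_
  · rintro _ ⟨y, rfl⟩
    obtain ⟨z, rfl⟩ := M.homologyMk_surjective i y
    rw [LinearMap.mem_ker, Hom.homologyMap_mk, Hom.homologyMap_mk, homologyMk_eq_zero]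
    exact ⟨0, zero_mem _, map_zero _⟩
  · obtain ⟨⟨⟨m, b⟩, hmb, hd⟩, rfl⟩ := homologyMk_surjective _ i y
    obtain ⟨hm, hb⟩ := mem_attach.1 hmb
    rw [LinearMap.mem_ker, Hom.homologyMap_mk, homologyMk_eq_zero] at hy
    obtain ⟨c, hc, hcb⟩ := hy
    have hcb' : B.d c = b := hcb
    have hd' := (Prod.mk.inj ((attach_d m b).symm.trans hd)).1
    have hcx : B.sgn 1 c • (x : M) ∈ M.gr i :=
      M.smul_mem' (by ring) (DGAlgebra.sgn_mem 1 hc) x.2.1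
    -- Subtracting the boundary `(± c x, d c)` of `(0, c)` moves the cycle `(m, b)` into `M`.
    refine ⟨M.homologyMk i ⟨m - B.sgn 1 c • (x : M), sub_mem hm hcx, ?_⟩, ?_⟩
    · rw [map_sub, M.d_smul_eq, x.2.2, smul_zero, add_zero, DGAlgebra.d_sgn, hcb',
        ← hd']
      simp
    · rw [Hom.homologyMap_mk, eq_comm, ← sub_eq_zero, ← map_sub, homologyMk_eq_zero]
      refine ⟨((0, c) : M × B), mem_attach.2 ⟨zero_mem _, hc⟩, ?_⟩
      rw [attach_d, map_zero, zero_add]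
      change ((B.sgn 1 c • (x : M), B.d c) : M × B) = (m, b) - (m - B.sgn 1 c • (x : M), 0)
      rw [hcb']
      simp

section Fibre

variable {F : DGModule.{u, v} B} (h : Hom F (M.attach x))

/-- The homotopy fibre of the composition of `h : F → M.attach x` with the projection onto the free
DG module on the attached cell. -/
noncomputable abbrev attachFibre : DGModule.{u, max u v} B :=
  twist (free B n) F
    (-((B.sgn 1).comp ((LinearMap.snd B M B).toAddMonoidHom.comp h.toLinearMap.toAddMonoidHom)))
    (fun i y hy => neg_mem (by
      have : B.sgn 1 (h.toLinearMap y).2 ∈ B.gr (i - (n + 1)) :=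
        DGAlgebra.sgn_mem 1 (mem_attach.1 (h.map_gr hy)).2
      rwa [add_comm, ← sub_sub] at this))
    (fun y => by
      change -B.sgn 1 (h.toLinearMap (F.d y)).2 = -B.d (-B.sgn 1 (h.toLinearMap y).2)
      rw [h.map_d, map_neg, DGAlgebra.d_sgn]
      simp)
    (fun b y => by
      change -B.sgn 1 (h.toLinearMap (b • y)).2 = B.sgn 1 b * -B.sgn 1 (h.toLinearMap y).2
      rw [map_smul, mul_neg, ← DGAlgebra.sgn_mul]
      rfl)

variable {h}

theorem attachFibre_d (b : B) (y : F) :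
    (attachFibre h).d (b, y) = (B.d b - B.sgn 1 (h.toLinearMap y).2, F.d y) :=
  Prod.ext (sub_eq_add_neg _ _).symm rfl

theorem mem_attachFibre {i : ℤ} {b : B} {y : F} :
    ((b, y) : B × F) ∈ (attachFibre h).gr i ↔ b ∈ B.gr (i - n) ∧ y ∈ F.gr i := Iff.rfl

theorem attach_map_d_fst (y : F) : (h.toLinearMap (F.d y)).1 =
    M.d (h.toLinearMap y).1 + B.sgn 1 (h.toLinearMap y).2 • (x : M) := by
  rw [h.map_d]
  rfl

variable (h)

/-- The map from the homotopy fibre to `M`. -/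
noncomputable def attachFibreHom : Hom (attachFibre h) M where
  toLinearMap := LinearMap.coprod (LinearMap.toSpanSingleton B M x)
    ((LinearMap.fst B M B).comp h.toLinearMap)
  map_gr {i z} hz := by
    obtain ⟨b, y⟩ := z
    obtain ⟨hb, hy⟩ := mem_attachFibre.1 hz
    exact add_mem (M.smul_mem' (by ring) hb x.2.1) (mem_attach.1 (h.map_gr hy)).1
  map_d z := by
    obtain ⟨b, y⟩ := z
    rw [attachFibre_d]
    change (B.d b - B.sgn 1 (h.toLinearMap y).2) • (x : M) + (h.toLinearMap (F.d y)).1 =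
      M.d (b • (x : M) + (h.toLinearMap y).1)
    rw [attach_map_d_fst, map_add, M.d_smul_eq, x.2.2, smul_zero, sub_smul]
    abel

theorem attachFibreHom_apply (b : B) (y : F) :
    (attachFibreHom h).toLinearMap (b, y) = b • (x : M) + (h.toLinearMap y).1 := rfl

variable {h}

/-- Up to quasi-isomorphism `M` is the homotopy fibre of `M.attach x → B[n+1]`, and replacing
`M.attach x` by `F` does not change the fibre. The argument on elements uses the exactness of the
cone of `h` for injectivity and the surjectivity of `H(h)` for surjectivity. -/
theorem isQuasiIso_attachFibreHom (hh : h.IsQuasiIso) : (attachFibreHom h).IsQuasiIso := by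
  intro i
  constructor
  · rw [Hom.homologyMap_injective_iff]
    rintro ⟨b, y⟩ hby hd m hm hmz
    obtain ⟨hb, hy⟩ := mem_attachFibre.1 hby
    rw [attachFibreHom_apply] at hmz
    obtain ⟨hdb, hdy⟩ := Prod.mk.inj ((attachFibre_d b y).symm.trans hd)
    rw [sub_eq_zero] at hdb
    -- This element is chosen so that its boundary in `M.attach x` is `h y`: the term `b • x` in `d
    -- m` is cancelled by the boundary of the second component.
    have hw : ((m, -B.sgn 1 b) : M × B) ∈ (M.attach x).gr (i + 1) :=
      mem_attach.2 ⟨hm, neg_mem (by simpa using DGAlgebra.sgn_mem 1 hb)⟩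
    obtain ⟨y', hy', ⟨m', c⟩, hmc, rfl, hd'⟩ := hh.exists_cone hy hw hdy (by
      rw [attach_d, map_neg, map_neg, DGAlgebra.sgn_sgn_self, neg_smul, hmz, DGAlgebra.d_sgn, hdb,
        DGAlgebra.sgn_sgn_self]
      refine Prod.ext ?_ ?_
      · change _ + _ + -_ = _
        abel
      · simp)
    obtain ⟨-, hc⟩ := mem_attach.1 hmc
    have hsnd : B.d c = -B.sgn 1 b - (h.toLinearMap y').2 := congrArg Prod.snd hd'
    refine ⟨((B.sgn 1 c, y') : B × F), mem_attachFibre.2 ⟨DGAlgebra.sgn_mem 1 (by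
      simpa [add_sub_add_right_eq_sub] using hc), hy'⟩, ?_⟩
    rw [attachFibre_d]
    refine Prod.ext ?_ rfl
    change B.d (B.sgn 1 c) - B.sgn 1 (h.toLinearMap y').2 = b
    rw [DGAlgebra.d_sgn, hsnd, map_sub, map_neg, DGAlgebra.sgn_sgn_self]
    simp
  · rw [Hom.homologyMap_surjective_iff]
    intro z hz hdz
    obtain ⟨y, hy, hdy, ⟨m, b⟩, hmb, hd⟩ := h.homologyMap_surjective_iff.1 (hh i).2
      ((z, 0) : M × B) (mem_attach.2 ⟨hz, zero_mem _⟩) (by rw [attach_d, hdz]; simp)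
    obtain ⟨hm, hb⟩ := mem_attach.1 hmb
    have hfst : M.d m + B.sgn 1 b • (x : M) = z - (h.toLinearMap y).1 := congrArg Prod.fst hd
    have hsnd : B.d b = 0 - (h.toLinearMap y).2 := congrArg Prod.snd hd
    refine ⟨((B.sgn 1 b, y) : B × F), mem_attachFibre.2 ⟨DGAlgebra.sgn_mem 1 (by
      simpa [add_sub_add_right_eq_sub] using hb), hy⟩, ?_, m, hm, ?_⟩
    · rw [attachFibre_d, hdy, DGAlgebra.d_sgn, hsnd]
      simp
    · rw [attachFibreHom_apply, sub_add_eq_sub_sub_swap, ← hfst, add_sub_cancel_right]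

/-- The basis of `B × F` obtained from a basis of `F` by putting `(1, 0)` first. -/
noncomputable def prodLexBasis {k : ℕ} (b : Module.Basis (Fin k) B F) :
    Module.Basis (Lex (Fin 1 ⊕ Fin k)) B (B × F) :=
  ((Module.Basis.singleton (Fin 1) B).prod b).reindex toLex

theorem prodLexBasis_inl {k : ℕ} (b : Module.Basis (Fin k) B F) (e : Fin 1) :
    prodLexBasis b (toLex (Sum.inl e)) = (1, 0) := by
  rw [prodLexBasis, Module.Basis.reindex_apply]
  exact Prod.ext (by simp) (by simp)

theorem prodLexBasis_inr {k : ℕ} (b : Module.Basis (Fin k) B F) (e : Fin k) :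
    prodLexBasis b (toLex (Sum.inr e)) = (0, b e) := by
  rw [prodLexBasis, Module.Basis.reindex_apply]
  exact Prod.ext (by simp) (by simp)

theorem prodLexBasis_repr_inr {k : ℕ} (b : Module.Basis (Fin k) B F) (z : B × F) (e : Fin k) :
    (prodLexBasis b).repr z (toLex (Sum.inr e)) = b.repr z.2 e := by
  rw [prodLexBasis, Module.Basis.repr_reindex_apply]
  simp

/-- The semibasis of the homotopy fibre. -/
noncomputable def attachFibreOrderedBasis {k : ℕ} (E : OrderedBasis F (Fin k)) :
    OrderedBasis (attachFibre h) (Lex (Fin 1 ⊕ Fin k)) where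
  basis := prodLexBasis E.basis
  deg e := Sum.elim (fun _ => n) E.deg (ofLex e)
  mem e := by
    rcases e with e | e
    · rw [show prodLexBasis E.basis (Sum.inl e) = (1, 0) from prodLexBasis_inl _ e]
      refine mem_attachFibre.2 ⟨?_, zero_mem _⟩
      change (1 : B) ∈ B.gr (n - n)
      rw [sub_self]
      exact B.one_mem_gr
    · rw [show prodLexBasis E.basis (Sum.inr e) = (0, E.basis e) from prodLexBasis_inr _ e]
      exact mem_attachFibre.2 ⟨zero_mem _, E.mem e⟩
  repr_d e e' hee' := by
    rcases e with e | e
    · rw [show prodLexBasis E.basis (Sum.inl e) = (1, 0) from prodLexBasis_inl _ e, attachFibre_d,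
        B.d_one, map_zero, map_zero]
      change (prodLexBasis E.basis).repr ((0 - B.sgn 1 0, 0) : B × F) e' = 0
      rw [map_zero, sub_zero]
      exact DFunLike.congr_fun (map_zero (prodLexBasis E.basis).repr) e'
    · rcases e' with e' | e'
      · exact absurd hee' (not_le.2 (Sum.Lex.inl_lt_inr e' e))
      · rw [show prodLexBasis E.basis (Sum.inr e) = (0, E.basis e) from prodLexBasis_inr _ e,
          attachFibre_d]
        exact (prodLexBasis_repr_inr E.basis _ e').trans
          (E.repr_d e e' (Sum.Lex.inr_le_inr_iff.1 hee'))

theorem isFiniteSemifree_attachFibre [Nontrivial B] (hF : F.IsFiniteSemifree) :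
    (attachFibre h).IsFiniteSemifree := by
  obtain ⟨k, ⟨E⟩⟩ := hF.exists_orderedBasis
  exact (attachFibreOrderedBasis E).isFiniteSemifree

end Fibre

end Attach

end DGModule

/-! ### Nakayama's lemma, functionals to the residue field, and `Tor` of an attached cell -/

/-- The vector space `N / I N` over `R ⧸ I` has enough functionals; one that is nonzero at `x` is
rescaled. The scalar rule is spelled out so that the values can later be moved into the residue
field of `B₀`. -/
theorem exists_functional_of_notMem_smul_top {R N : Type*} [CommRing R] {I : Ideal R}
    [I.IsMaximal] [AddCommGroup N] [Module R N] {x : N} (hx : x ∉ I • (⊤ : Submodule R N)) :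
    ∃ l : N →+ R ⧸ I, (∀ (r : R) y, l (r • y) = Ideal.Quotient.mk I r * l y) ∧ l x = 1 := by
  let _ : Field (R ⧸ I) := Ideal.Quotient.field I
  let V := N ⧸ I • (⊤ : Submodule R N)
  have hv : (Submodule.Quotient.mk x : V) ≠ 0 := by
    rwa [Ne, Submodule.Quotient.mk_eq_zero]
  obtain ⟨φ, hφ⟩ := not_forall.1 (mt (Module.forall_dual_apply_eq_zero_iff (R ⧸ I) _).1 hv)
  refine ⟨((AddMonoidHom.mulLeft (φ (Submodule.Quotient.mk x))⁻¹).comp φ.toAddMonoidHom).comp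
    (Submodule.mkQ _).toAddMonoidHom, fun r y => ?_, inv_mul_cancel₀ hφ⟩
  change _ * φ (Ideal.Quotient.mk I r • (Submodule.Quotient.mk y : V)) = _ * (_ * _)
  rw [map_smul, smul_eq_mul, mul_left_comm]
  rfl

/-- Nakayama: otherwise `N = 𝔪 N`. Choosing `x` inside the given generating set is what lets the
number of generators drop when `x` is killed. -/
theorem exists_mem_notMem_smul_top {R N : Type*} [CommRing R] [IsLocalRing R] [AddCommGroup N]
    [Module R N] [Module.Finite R N] [Nontrivial N] {s : Set N} (hs : Submodule.span R s = ⊤) :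
    ∃ x ∈ s, x ∉ IsLocalRing.maximalIdeal R • (⊤ : Submodule R N) := by
  by_contra! h
  refine Submodule.top_ne_ideal_smul_of_le_jacobson_annihilator (R := R) (M := N)
    (IsLocalRing.maximalIdeal_le_jacobson _) (le_antisymm ?_ le_top)
  rw [← hs, Submodule.span_le, hs]
  exact h

namespace DGModule

variable {B : DGAlgebra.{u}}

section TensorAttach

variable {M : DGModule.{u, v} B} {n : ℤ} {x : M.cycles n} {G : DGModule.{u, w} B}

/-- The coefficient of the attached cell in `M.attach x ⊗[B] G`. -/
noncomputable def tensorCell : Tensor (M.attach x) G →+ G :=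
  tensorLift ((smulAddHom B G).comp ((B.sgn (n + 1)).comp (AddMonoidHom.snd M B)))
    fun j l hl a g => by
      obtain ⟨m, b⟩ := l
      obtain ⟨-, hb⟩ := mem_attach.1 hl
      change B.sgn (n + 1) (B.sgn j a * b) • g = B.sgn (n + 1) b • a • g
      rw [smul_smul, DGAlgebra.mul_comm_of_mem _ hb, DGAlgebra.sgn_mul, DGAlgebra.sgn_sgn,
        DGAlgebra.sgn_sgn, DGAlgebra.sgn_of_even (b := a) ⟨j, by ring⟩]

variable (M x) in
/-- The attached cell. -/
def attachCell : M.attach x := ((0, 1) : M × B)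

theorem attachCell_mem : M.attachCell x ∈ (M.attach x).gr (n + 1) :=
  mem_attach.2 ⟨zero_mem _, by simpa using B.one_mem_gr⟩

theorem d_attachCell : (M.attach x).d (M.attachCell x) = (M.attachInl x).toLinearMap x := by
  rw [attachCell, attach_d, B.d_one, DGAlgebra.sgn_one, one_smul, map_zero, zero_add]
  rfl

theorem tensorCell_tmk (m : M) (b : B) (g : G) :
    tensorCell (tmk (M.attach x) G (m, b) g) = B.sgn (n + 1) b • g := rfl

theorem tensorCell_mem {j : ℤ} {z : Tensor (M.attach x) G} (hz : z ∈ tensorGr (M.attach x) G j) :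
    tensorCell z ∈ G.gr (j - (n + 1)) := by
  refine map_tensorGr_le _ j _ (fun i k hik l hl g hg => ?_) z hz
  obtain ⟨m, b⟩ := l
  exact G.smul_mem' (by lia) (DGAlgebra.sgn_mem _ (mem_attach.1 hl).2) hg

theorem tensorCell_tensor (z : Tensor M G) : tensorCell ((M.attachInl x).tensor G z) = 0 := by
  induction z using tensor_induction with
  | hadd y z hy hz => rw [map_add, map_add, hy, hz, add_zero]
  | h i m hm g =>
    rw [Hom.tensor_tmk]
    refine (tensorCell_tmk (x := x) m 0 g).trans ?_
    rw [map_zero, zero_smul]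

theorem tensorCell_cell (g : G) : tensorCell (tmk _ G (M.attachCell x) g) = g := by
  rw [attachCell, tensorCell_tmk, DGAlgebra.sgn_one, one_smul]

/-- The retraction of `M.attach x ⊗[B] G` onto `M ⊗[B] G`; it is not a chain map. -/
noncomputable def tensorFst : Tensor (M.attach x) G →+ Tensor M G :=
  tensorMap (L := M.attach x) (LinearMap.fst B M B) (fun _ _ hm => (mem_attach.1 hm).1) G

theorem tensorFst_tensor (z : Tensor M G) : tensorFst ((M.attachInl x).tensor G z) = z := by
  induction z using tensor_induction with
  | hadd y z hy hz => rw [map_add, map_add, hy, hz]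
  | h i m hm g => rfl

theorem tensorFst_cell (g : G) : tensorFst (tmk _ G (M.attachCell x) g) = 0 := by
  change tmk M G 0 g = 0
  rw [map_zero]
  rfl

/-- As a graded group the tensor product splits into `M ⊗[B] G` and a copy of `G` on the cell, with
coordinates `tensorFst` and `tensorCell`. In these coordinates the differential is triangular with
off-diagonal entry `g ↦ x ⊗ g`, the connecting map. -/
theorem tensor_attach_eq (z : Tensor (M.attach x) G) :
    z = (M.attachInl x).tensor G (tensorFst z) + tmk _ G (M.attachCell x) (tensorCell z) := by
  induction z using tensor_induction with
  | hadd y z hy hz =>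
    rw [map_add, map_add, map_add, map_add, add_add_add_comm, ← hy, ← hz]
  | h i l hl g =>
    obtain ⟨m, b⟩ := l
    rw [tensorCell_tmk, tmk_smul_right attachCell_mem, DGAlgebra.sgn_sgn_self]
    change _ = tmk (M.attach x) G ((m, 0) : M × B) g +
      tmk (M.attach x) G (b • ((0, 1) : M × B)) g
    rw [← AddMonoidHom.add_apply, ← map_add]
    congr 2
    exact Prod.ext (by simp) (by simp)

theorem tensorD_cell (g : G) : tensorD _ G (tmk _ G (M.attachCell x) g) =
    (M.attachInl x).tensor G (tmk M G x g) +
      (n + 1).negOnePow • tmk _ G (M.attachCell x) (G.d g) := by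
  rw [tensorD_tmk attachCell_mem, d_attachCell, Hom.tensor_tmk]

theorem tensorFst_d (z : Tensor (M.attach x) G) :
    tensorFst (tensorD _ G z) = tensorD M G (tensorFst z) + tmk M G x (tensorCell z) := by
  conv_lhs => rw [tensor_attach_eq z]
  rw [map_add, ← Hom.tensor_d, tensorD_cell, map_add, map_add, tensorFst_tensor, tensorFst_tensor,
    AddMonoidHom.map_intUnits_smul, tensorFst_cell, smul_zero, add_zero]

theorem tensorCell_d (z : Tensor (M.attach x) G) :
    tensorCell (tensorD _ G z) = (n + 1).negOnePow • G.d (tensorCell z) := by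
  conv_lhs => rw [tensor_attach_eq z]
  rw [map_add, ← Hom.tensor_d, tensorD_cell, map_add, map_add, tensorCell_tensor,
    tensorCell_tensor, AddMonoidHom.map_intUnits_smul, tensorCell_cell, zero_add, zero_add]

/-- Vanishing of `H(M.attach x ⊗[B] G)` in degree `j`, from vanishing of `H(M ⊗[B] G)` in
degree `j` and injectivity of the connecting map. -/
theorem subsingleton_tensorHomology_attach {j : ℤ} (hM : Subsingleton (tensorHomology M G j))
    (hG : ∀ g ∈ G.gr (j - (n + 1)), G.d g = 0 → ∀ u, tensorD M G u = tmk M G x g →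
      ∃ g' ∈ G.gr (j - (n + 1) + 1), G.d g' = g) :
    Subsingleton (tensorHomology (M.attach x) G j) := by
  rw [subsingleton_tensorHomology_iff] at hM ⊢
  intro z hz hdz
  have hdg : G.d (tensorCell z) = 0 := by
    have h := tensorCell_d z
    rw [hdz, map_zero] at h
    rcases Int.units_eq_one_or (n + 1).negOnePow with h' | h' <;> rw [h'] at h <;> simpa using h.symm
  have hu : tensorD M G (-tensorFst z) = tmk M G x (tensorCell z) := by
    have h := tensorFst_d z
    rw [hdz, map_zero] at h
    rw [map_neg]
    exact neg_eq_of_add_eq_zero_right h.symm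
  obtain ⟨g', hg', hgg'⟩ := hG _ (tensorCell_mem hz) hdg _ hu
  -- `tensorCell` commutes with the differentials only up to `(-1) ^ (n + 1)`. With this sign, `z -
  -- d c` has zero cell coefficient and so comes from `M ⊗[B] G`.
  let c := (n + 1).negOnePow • tmk _ G (M.attachCell x) g'
  have hc : c ∈ tensorGr (M.attach x) G (j + 1) :=
    AddSubgroup.intUnits_smul_mem _ _ (tmk_mem (by ring) attachCell_mem hg')
  have hz' : z - tensorD _ G c ∈ tensorGr (M.attach x) G j := sub_mem hz (tensorD_mem rfl hc)
  have hcell : tensorCell (z - tensorD _ G c) = 0 := by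
    rw [map_sub, tensorCell_d, AddMonoidHom.map_intUnits_smul, tensorCell_cell,
      AddMonoidHom.map_intUnits_smul, Int.negOnePow_smul_smul,
      Int.negOnePow_smul_of_even (Even.add_self _), hgg', sub_self]
  have hdz' : tensorD _ G (z - tensorD _ G c) = 0 := by
    rw [map_sub, hdz, tensorD_tensorD, sub_zero]
  have hd : tensorD M G (tensorFst (z - tensorD _ G c)) = 0 := by
    have h := tensorFst_d (z - tensorD _ G c)
    rw [hdz', hcell, map_zero, map_zero, add_zero] at h
    exact h.symm
  obtain ⟨w, hw, hwz⟩ := hM _ (tensorMap_mem _ _ hz') hd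
  refine ⟨(M.attachInl x).tensor G w + c, add_mem (Hom.tensor_mem _ hw) hc, ?_⟩
  have h := tensor_attach_eq (z - tensorD _ G c)
  rw [hcell, map_zero, add_zero] at h
  rw [map_add, ← Hom.tensor_d, hwz]
  exact (congrArg (· + tensorD _ G c) h).symm.trans (sub_add_cancel _ _)

end TensorAttach

section Functional

variable (hB : B.IsLocal)

/-- A functional on `M` with values in the residue field that vanishes on boundaries. -/
structure ResidueFunctional (M : DGModule.{u, v} B) where
  toFun : M →+ hB.residueField
  map_smul : ∀ (b : B) (m : M), toFun (b • m) = hB.augmentation b * toFun m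
  map_d : ∀ m : M, toFun (M.d m) = 0

variable {hB}

/-- The augmentation sees only degree zero, where Koszul signs are trivial. -/
theorem augmentation_sgn (j : ℤ) (b : B) : hB.augmentation (B.sgn j b) = hB.augmentation b := by
  induction b using homogeneous_induction B.gr with
  | hadd x y hx hy => simp only [map_add, hx, hy]
  | h i b hb =>
    by_cases hi : i = 0
    · rw [DGAlgebra.sgn_of_mem _ hb, hi, zero_mul, Int.negOnePow_zero, one_smul]
    · rw [hB.augmentation_of_ne hi hb, hB.augmentation_of_ne hi (DGAlgebra.sgn_mem j hb)]

/-- A morphism to the residue field, as an additive map with values in the field. -/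
noncomputable def Hom.toResidueField {G : DGModule.{u, w} B} (f : Hom G hB.residueDGModule) :
    G →+ hB.residueField := f.toLinearMap.toAddMonoidHom

theorem Hom.toResidueField_smul {G : DGModule.{u, w} B} (f : Hom G hB.residueDGModule) (b : B)
    (g : G) : f.toResidueField (b • g) = hB.augmentation b * f.toResidueField g :=
  f.toLinearMap.map_smul b g

theorem Hom.toResidueField_d {G : DGModule.{u, w} B} (f : Hom G hB.residueDGModule) (g : G) :
    f.toResidueField (G.d g) = 0 := f.map_d g

namespace ResidueFunctional

variable {M : DGModule.{u, v} B} (l : ResidueFunctional hB M) {G : DGModule.{u, w} B}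
  (f : Hom G hB.residueDGModule)

/-- The functional `m ⊗ g ↦ l m * f g`. -/
noncomputable def pairing : Tensor M G →+ hB.residueField :=
  tensorLift (((AddMonoidHom.mul.comp l.toFun).flip.comp f.toResidueField).flip) fun j m _ b g => by
    change l.toFun (B.sgn j b • m) * f.toResidueField g = l.toFun m * f.toResidueField (b • g)
    rw [l.map_smul, augmentation_sgn, f.toResidueField_smul]
    ring

theorem pairing_tmk (m : M) (g : G) :
    l.pairing f (tmk M G m g) = l.toFun m * f.toResidueField g := rfl

theorem pairing_d (z : Tensor M G) : l.pairing f (tensorD M G z) = 0 := by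
  induction z using tensor_induction with
  | hadd y z hy hz => rw [map_add, map_add, hy, hz, add_zero]
  | h i m hm g =>
    rw [tensorD_tmk hm, map_add, AddMonoidHom.map_intUnits_smul, pairing_tmk, pairing_tmk,
      l.map_d, f.toResidueField_d, zero_mul, mul_zero, smul_zero, add_zero]

end ResidueFunctional

theorem augmentation_cyclesZero_eq_zero [IsLocalRing B.cyclesZero] {r : B.cyclesZero}
    (hr : r ∈ IsLocalRing.maximalIdeal B.cyclesZero) : hB.augmentation (r : B) = 0 := by
  let := hB.isLocalRing
  change IsLocalRing.residue (B.gr 0) (DGAlgebra.projZero hB.gr_neg (r : B)) = 0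
  rw [DGAlgebra.projZero_of_mem _ r.2.1, IsLocalRing.residue_eq_zero_iff,
    IsLocalRing.mem_maximalIdeal, mem_nonunits_iff]
  intro h
  exact (IsLocalRing.mem_maximalIdeal r).1 hr (h.map hB.grZeroEquiv)

/-- A homology class in the lowest degree that is not in `𝔪 H(M)` is detected by a functional. -/
theorem exists_residueFunctional [IsLocalRing B.cyclesZero] {M : DGModule.{u, v} B} {n : ℤ}
    (hM : ∀ i < n, M.gr i = ⊥) {z : M.cycles n}
    (hz : M.homologyMk n z ∉ IsLocalRing.maximalIdeal B.cyclesZero •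
      (⊤ : Submodule B.cyclesZero (M.homology n))) :
    ∃ l : ResidueFunctional hB M, l.toFun z = 1 := by
  obtain ⟨l, hl, hlz⟩ := exists_functional_of_notMem_smul_top hz
  let ψ : B.cyclesZero ⧸ IsLocalRing.maximalIdeal B.cyclesZero →+* hB.residueField :=
    Ideal.Quotient.lift _ (hB.augmentation.comp B.cyclesZero.subtype)
      fun r hr => augmentation_cyclesZero_eq_zero hr
  -- Since `M` is zero in degree `n - 1`, everything in degree `n` is a cycle. The functional
  -- projects to degree `n`, passes to homology and applies `l`.
  let c : M →+ M.cycles n :=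
    { toFun := fun m => ⟨homogeneousProj M.gr n m, homogeneousProj_mem _ _ _, by
        have := M.d_mem (homogeneousProj_mem M.gr n m)
        rwa [hM _ (by lia)] at this⟩
      map_zero' := Subtype.ext (map_zero _)
      map_add' := fun x y => Subtype.ext (map_add _ _ _) }
  have hc : ∀ {m : M} (hm : m ∈ M.gr n), (c m : M) = m := fun hm => homogeneousProj_of_mem _ hm
  have hc0 : ∀ {i : ℤ} {m : M}, i ≠ n → m ∈ M.gr i → c m = 0 := fun hi hm =>
    Subtype.ext (homogeneousProj_of_ne _ hi hm)
  let t : M.homology n →+ hB.residueField := ψ.toAddMonoidHom.comp l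
  have ht : ∀ (r : B.cyclesZero) y, t (r • y) = hB.augmentation (r : B) * t y := fun r y => by
    change ψ (l (r • y)) = _ * ψ (l y)
    rw [hl, map_mul]
    rfl
  let Λ : M →+ hB.residueField := t.comp ((M.homologyMk n).toAddMonoidHom.comp c)
  have hΛ : ∀ m, Λ m = t (M.homologyMk n (c m)) := fun _ => rfl
  refine ⟨⟨Λ, fun b m => ?_, fun m => ?_⟩, ?_⟩
  · induction b using homogeneous_induction B.gr with
    | hadd x y hx hy => rw [add_smul, map_add, hx, hy, map_add, add_mul]
    | h i b hb =>
      induction m using homogeneous_induction M.gr with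
      | hadd x y hx hy => rw [smul_add, map_add, hx, hy, map_add, mul_add]
      | h j m hm =>
        by_cases hi : i = 0
        · subst hi
          by_cases hj : j = n
          · subst hj
            have : c (b • m) = (⟨b, hb, hB.d_eq_zero hb⟩ : B.cyclesZero) • c m := by
              refine Subtype.ext ((hc (M.smul_mem' (zero_add _) hb hm)).trans ?_)
              change b • m = b • (c m : M)
              rw [hc hm]
            rw [hΛ, hΛ, this, map_smul, ht]
          · rw [hΛ, hΛ, hc0 hj hm, hc0 hj (M.smul_mem' (zero_add _) hb hm)]
            simp
        -- Linearity for `b` of nonzero degree: the augmentation kills `b`, and multiplication by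
        -- `b` of positive degree pushes `M` above degree `n`, where the functional vanishes.
        · rw [hB.augmentation_of_ne hi hb, zero_mul]
          rcases lt_or_ge i 0 with hi' | hi'
          · rw [hB.gr_neg i hi', AddSubgroup.mem_bot] at hb
            rw [hb, zero_smul, map_zero]
          · rcases lt_or_ge j n with hj | hj
            · rw [hM j hj, AddSubgroup.mem_bot] at hm
              rw [hm, smul_zero, map_zero]
            · rw [hΛ, hc0 (i := i + j) (by lia) (M.smul_mem hb hm), map_zero, map_zero]
  · induction m using homogeneous_induction M.gr with
    | hadd x y hx hy => rw [map_add, map_add, hx, hy, add_zero]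
    | h j m hm =>
      rw [hΛ]
      by_cases hj : j = n + 1
      · subst hj
        rw [M.homologyMk_eq_zero.2 ⟨m, hm, (hc (M.d_mem' rfl hm)).symm⟩, map_zero]
      · rw [hc0 (i := j - 1) (by lia) (M.d_mem hm), map_zero, map_zero]
  · change t (M.homologyMk n (c z)) = 1
    have : c z = z := Subtype.ext (hc z.2.1)
    rw [this]
    change ψ (l _) = 1
    rw [hlz, map_one]

end Functional

/-! ### The inductive construction of a finite semifree resolution -/

section Main

variable (hB : B.IsLocal)

/-- A bounded below DG module whose homology is finitely generated in its lowest degree `n` has a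
quasi-isomorphic replacement concentrated in degrees at least `n`, in which a prescribed generating
set of the homology in degree `n` contains a class that is detected by a functional. -/
theorem exists_cellular_functional {M : DGModule.{u, max u v} B} {n : ℤ}
    (hM : ∀ i < n, Subsingleton (M.homology i)) (hfin : M.HomologyDegreewiseFinite)
    (hn : Nontrivial (M.homology n)) {s : Set (M.homology n)}
    (hs : Submodule.span B.cyclesZero s = ⊤) :
    ∃ (z : (cellular M n).cycles n) (l : ResidueFunctional hB (cellular M n)), l.toFun z = 1 ∧
      (cellularHom n).homologyMap n ((cellular M n).homologyMk n z) ∈ s := by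
  have := hB.isLocalRing_cyclesZero
  have := (finite_homology_iff _ _).1 (hfin n)
  let φ : (cellular M n).homology n ≃ₗ[B.cyclesZero] M.homology n :=
    LinearEquiv.ofBijective _ (isQuasiIso_cellularHom n hB.gr_neg hM n)
  have := Module.Finite.equiv φ.symm
  have := φ.toEquiv.nontrivial
  obtain ⟨y, hy, hy'⟩ := exists_mem_notMem_smul_top (R := B.cyclesZero) (s := φ.symm '' s) (by
    rw [← LinearEquiv.coe_coe, Submodule.span_image, hs, Submodule.map_top, LinearEquiv.range])
  obtain ⟨y, hys, rfl⟩ := hy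
  obtain ⟨z, hz⟩ := homologyMk_surjective _ _ (φ.symm y)
  rw [← hz] at hy'
  obtain ⟨l, hl⟩ := exists_residueFunctional (hB := hB)
    (fun i hi => cellular_gr_eq_bot n hB.gr_neg hi) hy'
  refine ⟨z, l, hl, ?_⟩
  rw [hz]
  exact (φ.apply_symm_apply y).symm ▸ hys

/-- If not, let `l` detect a cycle `z` of degree `n` in the cellular replacement, and let the cycle
`g` lift `1 ∈ k` to the resolution of `k`. Then `z ⊗ g` is a cycle, hence a boundary, but the
pairing of `l` with the augmentation of the resolution is `1` on it and kills boundaries. -/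
theorem subsingleton_homology_of_tor {M : DGModule.{u, max u v} B} {n : ℤ}
    (hM : ∀ i < n, Subsingleton (M.homology i)) (hfin : M.HomologyDegreewiseFinite)
    (hT : Subsingleton (Tor M hB.residueDGModule n)) : Subsingleton (M.homology n) := by
  by_contra hn
  rw [not_subsingleton_iff_nontrivial] at hn
  obtain ⟨z, l, hl, -⟩ := exists_cellular_functional hB hM hfin hn Submodule.span_univ
  obtain ⟨-, f, hf⟩ := isSemifreeResolutionOf_residue hB
  obtain ⟨g, hg, hdg, w, -, hw⟩ := f.homologyMap_surjective_iff.1 (hf 0).2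
    (show hB.residueField from 1) (mem_grConcentrated_zero _) rfl
  have hg1 : f.toResidueField g = 1 := (sub_eq_zero.1 hw.symm).symm
  rw [← subsingleton_tor_iff hB (isQuasiIso_cellularHom n hB.gr_neg hM),
    subsingleton_tensorHomology_iff] at hT
  obtain ⟨w, -, hwz⟩ := hT (tmk _ _ z g) (tmk_mem (add_zero n) z.2.1 hg) (by
    rw [tensorD_tmk z.2.1, z.2.2, hdg, map_zero, map_zero, smul_zero, add_zero]
    rfl)
  have := l.pairing_d f w
  rw [hwz, ResidueFunctional.pairing_tmk, hl, hg1, one_mul] at this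
  exact one_ne_zero this

/-- The connecting map `g ↦ z ⊗ g` is injective in homology: if `z ⊗ g` is a boundary, the pairing
gives `f g = 0`, and then `g` is a boundary because `f` is a quasi-isomorphism. Hence killing a
class detected by `l` creates no new `Tor`. -/
theorem subsingleton_tor_attach {M : DGModule.{u, max u v} B} {n : ℤ} {z : M.cycles n}
    {l : ResidueFunctional hB M} (hl : l.toFun z = 1) {j : ℤ}
    (hT : Subsingleton (Tor M hB.residueDGModule j)) :
    Subsingleton (Tor (M.attach z) hB.residueDGModule j) := by
  obtain ⟨-, f, hf⟩ := isSemifreeResolutionOf_residue hB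
  refine subsingleton_tensorHomology_attach hT fun g hg hdg w hw => ?_
  have hg0 : f.toResidueField g = 0 := by
    have := l.pairing_d f w
    rwa [hw, ResidueFunctional.pairing_tmk, hl, one_mul] at this
  exact f.homologyMap_injective_iff.1 (hf _).1 g hg hdg 0 (zero_mem _)
    ((map_zero _).trans hg0.symm)

/-- A DG module with finitely generated homology in degrees at least `n`, and with vanishing `Tor`
in degrees at least `n + m`, has a finite semifree resolution. -/
theorem exists_finiteSemifree (m : ℕ) : ∀ (M : DGModule.{u, max u v} B) (n : ℤ),
    (∀ i < n, Subsingleton (M.homology i)) → M.HomologyDegreewiseFinite →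
    (∀ i, n + m ≤ i → Subsingleton (Tor M hB.residueDGModule i)) →
    ∃ F : DGModule.{u, max u v} B, F.IsFiniteSemifree ∧ ∃ f : Hom F M, f.IsQuasiIso := by
  have := hB.nontrivial
  have := hB.isNoetherianRing_cyclesZero
  induction m with
  | zero =>
    intro M n hM hfin hT
    -- All `Tor` in degrees at least `n` vanishes, so the lowest homology vanishes again and again.
    -- Thus `M` is acyclic and the zero module resolves it.
    have key : ∀ k : ℕ, ∀ i < n + k, Subsingleton (M.homology i) := by
      intro k
      induction k with
      | zero => simpa using hM
      | succ k ih =>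
        intro i hi
        rcases lt_or_ge i (n + k) with h | h
        · exact ih i h
        · obtain rfl : i = n + k := by push_cast at hi; lia
          exact subsingleton_homology_of_tor hB ih hfin (hT _ (by simp))
    refine ⟨zero B, ⟨∅, fun _ _ => False, Set.finite_empty, ?_⟩, ⟨0, fun _ => zero_mem _,
      fun _ => (map_zero M.d).symm⟩, ?_⟩
    · exact
        { isWellOrder := inferInstance
          homogeneous := fun f hf => hf.elim
          linearIndependent := linearIndependent_empty_type
          span_eq_top := Submodule.eq_top_iff'.2 fun _ => zero_mem (Submodule.span B ∅)
          d_mem_span := fun f => f.2.elim }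
    · intro i
      have := key (i - n + 1).toNat i (by lia)
      have : Subsingleton ((zero B).homology i) :=
        (subsingleton_homology_iff _).2 fun _ _ _ => ⟨0, zero_mem _, rfl⟩
      exact ⟨Function.injective_of_subsingleton _, fun y => ⟨0, Subsingleton.elim _ _⟩⟩
  | succ m ihm =>
    -- Inner induction on the number of generators of `H_n`. It ranges over all `M`, since attaching
    -- a cell replaces the module.
    have key : ∀ (r : ℕ) (M : DGModule.{u, max u v} B) (n : ℤ),
        (∀ i < n, Subsingleton (M.homology i)) → M.HomologyDegreewiseFinite →
        (∀ i, n + ((m + 1 : ℕ) : ℤ) ≤ i → Subsingleton (Tor M hB.residueDGModule i)) →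
        (∃ s : Finset (M.homology n), s.card ≤ r ∧
          Submodule.span B.cyclesZero (s : Set (M.homology n)) = ⊤) →
        ∃ F : DGModule.{u, max u v} B, F.IsFiniteSemifree ∧ ∃ f : Hom F M, f.IsQuasiIso := by
      intro r
      induction r with
      | zero =>
        rintro M n hM hfin hT ⟨s, hs, hspan⟩
        rw [Nat.le_zero, Finset.card_eq_zero] at hs
        have h : Subsingleton (M.homology n) := by
          rw [hs, Finset.coe_empty, Submodule.span_empty] at hspan
          exact (Submodule.subsingleton_iff B.cyclesZero).1 (subsingleton_of_bot_eq_top hspan)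
        -- With `H_n = 0` the lower bound rises to `n + 1`, while the upper bound `n + (m + 1) = (n
        -- + 1) + m` for `Tor` stays the same.
        refine ihm M (n + 1) (fun i hi => ?_) hfin fun i hi => hT i (by push_cast; lia)
        rcases lt_or_ge i n with h' | h'
        · exact hM i h'
        · obtain rfl : i = n := by lia
          exact h
      | succ r ihr =>
        rintro M n hM hfin hT ⟨s, hs, hspan⟩
        classical
        rcases subsingleton_or_nontrivial (M.homology n) with h | h
        · exact ihr M n hM hfin hT ⟨∅, by simp, Subsingleton.elim
            (h := (Submodule.subsingleton_iff B.cyclesZero).2 h) _ _⟩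
        have hq := isQuasiIso_cellularHom n hB.gr_neg hM
        obtain ⟨z, l, hl, hz⟩ := exists_cellular_functional hB hM hfin h hspan
        let φ : (cellular M n).homology n ≃ₗ[B.cyclesZero] M.homology n :=
          LinearEquiv.ofBijective _ (hq n)
        let N := (cellular M n).attach z
        let π : M.homology n →ₗ[B.cyclesZero] N.homology n :=
          (((cellular M n).attachInl z).homologyMap n).comp φ.symm.toLinearMap
        have hπ : Function.Surjective π :=
          (surjective_homologyMap_attachInl hB.gr_neg).comp φ.symm.surjective
        obtain ⟨y, hy⟩ : ∃ y, y = φ ((cellular M n).homologyMk n z) := ⟨_, rfl⟩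
        have hys : y ∈ s := hy ▸ hz
        have hy0 : π y = 0 := by
          change ((cellular M n).attachInl z).homologyMap n (φ.symm y) = 0
          rw [hy, φ.symm_apply_apply, homologyMap_attachInl_mk]
        obtain ⟨F, hF, f, hf⟩ := ihr N n
          (fun i hi => subsingleton_homology_attach hB.gr_neg hi.le
            ((hq.subsingleton_homology_iff i).2 (hM i hi)))
          (homologyDegreewiseFinite_attach hB.degreewiseFinite
            (hq.homologyDegreewiseFinite_iff.2 hfin))
          (fun i hi => subsingleton_tor_attach hB hl ((subsingleton_tor_iff hB hq i).2 (hT i hi)))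
          -- `π` is onto and kills `y`, the class of `z`, so the images of the other generators
          -- suffice.
          ⟨(s.erase y).image π, Finset.card_image_le.trans (by
              rw [Finset.card_erase_of_mem hys]; omega), by
            rw [Finset.coe_image, Submodule.span_image, eq_top_iff, ← LinearMap.range_eq_top.2 hπ,
              ← Submodule.map_top, ← hspan, Submodule.map_le_iff_le_comap, Submodule.span_le]
            intro x hx
            by_cases hxy : x = y
            · rw [hxy]
              exact SetLike.mem_coe.2 (Submodule.mem_comap.2 (hy0.symm ▸ zero_mem _))
            · exact Submodule.mem_map_of_mem (Submodule.subset_span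
                (Finset.mem_coe.2 (Finset.mem_erase.2 ⟨hxy, hx⟩)))⟩
        exact ⟨attachFibre f, isFiniteSemifree_attachFibre hF,
          (cellularHom n).comp (attachFibreHom f), hq.comp (isQuasiIso_attachFibreHom hf)⟩
    intro M n hM hfin hT
    obtain ⟨s, hs⟩ := ((finite_homology_iff _ _).1 (hfin n)).fg_top
    exact key s.card M n hM hfin hT ⟨s, le_rfl, hs⟩

theorem HomologicallyFinite.exists_finiteSemifree {M : DGModule.{u, max u v} B}
    (hM : M.HomologicallyFinite hB) :
    ∃ F : DGModule.{u, max u v} B, F.IsFiniteSemifree ∧ M.QuasiIsomorphic F := by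
  obtain ⟨⟨n, hn⟩, hfin, ⟨k, hk⟩⟩ := hM
  -- `Tor` vanishes from degree `k + 1` on; `toNat` also covers the case where `n` already exceeds
  -- `k + 1`.
  obtain ⟨F, hF, f, hf⟩ := DGModule.exists_finiteSemifree hB (k + 1 - n).toNat M n hn hfin
    fun i hi => hk i (lt_of_lt_of_le (by lia) (le_abs_self i))
  exact ⟨F, hF, .symm _ _ (.rel _ _ ⟨f, hf⟩)⟩

end Main

end DGModule

theorem proposition4p4 (B : DGAlgebra.{u}) (hB : B.IsLocal) (M : DGModule.{u, max u v} B) :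
    List.TFAE
      [M.IsPerfect,
        ∃ F : DGModule.{u, max u v} B, F.IsFiniteSemifree ∧ M.QuasiIsomorphic F,
        M.HomologyBoundedBelow ∧ M.HomologyDegreewiseFinite ∧
          DGModule.TorBounded M hB.residueDGModule] := by
  tfae_have 1 → 3 := fun h => h.homologicallyFinite hB
  tfae_have 3 → 2 := fun h => DGModule.HomologicallyFinite.exists_finiteSemifree hB h
  tfae_have 2 → 1 := fun ⟨_, hF, h⟩ => hF.isPerfect h
  tfae_finish
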